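/- Let $\mathsf{loss}:\mathbb{R}\to\mathbb{R}$ be convex and Lipschitz with $\operatorname{argmin}_x \mathsf{loss}(x)=\{0\}$, let $\delta>1$ be a real number, and let $G\sim N(0,1)$ and $Z$ be independent real random variables with $\mathbb{P}(Z\neq 0)>0$. For $x\in\mathbb{R}$, $\tau>0$, $\kappa>0$ write $$\mathsf{env}_{\mathsf{loss}}(x;\tau)=\min_{u\in\mathbb{R}}\Bigl(\tfrac{(x-u)^2}{2\tau}+\mathsf{loss}(u)\Bigr),\qquad \mathrm{prox}[\kappa\,\mathsf{loss}](x)=\operatorname{argmin}_{u\in\mathbb{R}}\Bigl(\kappa\,\mathsf{loss}(u)+\tfrac{(x-u)^2}{2}\Bigr),$$ and let $\partial\mathsf{loss}(z)=\{s\in\mathbb{R}:\mathsf{loss}(y)\ge \mathsf{loss}(z)+s(y-z)\ \text{for all } y\in\mathbb{R}\}$ be the subdifferential, $\mathrm{dist}(x,S)=\inf_{y\in S}|x-y|$ and $x_+=\max(0,x)$. For $\alpha\ge 0$ define the potential $$\mathsf{M}(\alpha)=\sup_{\beta>0}\,\inf_{\tau>0}\ \frac{\beta\tau}{2\delta}+\mathsf{L}\Bigl(\alpha,\frac{\tau}{\beta}\Bigr)-\frac{\alpha\beta}{\delta},\qquad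 \mathsf{L}(c,\tau)=\mathbb{E}\bigl[\mathsf{env}_{\mathsf{loss}}(cG+Z;\tau)-\mathsf{loss}(Z)\bigr].$$ Then the following hold. 1. $\mathsf{M}$ is finite on $[0,\infty)$ and the problem $\min_{\alpha\ge 0}\mathsf{M}(\alpha)$ admits a unique minimizer $\alpha_*\ge 0$. 2. If $$\delta<\delta_{\mathsf{perfect}}:=\frac{1}{\bigl(1-\inf_{t>0}\mathbb{E}[\mathrm{dist}(G,t\,\partial\mathsf{loss}(Z))^2]\bigr)_+}\in(0,+\infty]$$ (with $1/0=+\infty$), then $\alpha_*>0$, and there exists a unique $\kappa_*>0$ such that $(\alpha_*,\kappa_*)$ is a solution of the system $$\alpha^2=\delta\,\mathbb{E}\bigl[\bigl((\alpha G+Z)-\mathrm{prox}[\kappa\,\mathsf{loss}](\alpha G+Z)\bigr)^2\bigr],\qquad \alpha=\delta\,\mathbb{E}\bigl[\bigl((\alpha G+Z)-\mathrm{prox}[\kappa\,\mathsf{loss}](\alpha G+Z)\bigr)G\bigr];$$ moreover $(\alpha_*,\kappa_*)$ is the only solution of this system among all pairs $(\alpha,\kappa)$ with $\alpha>0$ and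 $\kappa>0$. -/

import Mathlib

open MeasureTheory ProbabilityTheory
open scoped ENNReal Pointwise

/-- The set of global minimizers of `f : ℝ → ℝ`. -/
def argminSet (f : ℝ → ℝ) : Set ℝ := {x | ∀ y, f x ≤ f y}

/-- The subdifferential `∂f(x)` of a function `f : ℝ → ℝ`. -/
def subdiff (f : ℝ → ℝ) (x : ℝ) : Set ℝ := {s | ∀ y, f x + s * (y - x) ≤ f y}

/-- The proximal operator `prox[f](x) = argmin_u f(u) + (x - u)² / 2`. For convex `f` the objective
is strictly convex and coercive, so that the point chosen is its one and only minimizer. -/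
noncomputable def prox (f : ℝ → ℝ) (x : ℝ) : ℝ :=
  Classical.epsilon fun u => u ∈ argminSet fun w => f w + (x - w) ^ 2 / 2

/-- The Moreau envelope `env_g(x; τ) = min_u (x - u)² / (2τ) + g(u)`. -/
noncomputable def moreauEnv (g : ℝ → ℝ) (x τ : ℝ) : ℝ :=
  ⨅ u : ℝ, ((x - u) ^ 2 / (2 * τ) + g u)

section Potential

variable {Ω : Type*} [MeasurableSpace Ω] (P : Measure Ω) (G Z : Ω → ℝ) (loss : ℝ → ℝ)

/-- `L(c, τ) = E[env_loss(cG + Z; τ) - loss(Z)]`. -/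
noncomputable def envL (c τ : ℝ) : ℝ :=
  ∫ ω, (moreauEnv loss (c * G ω + Z ω) τ - loss (Z ω)) ∂P

/-- The potential `M(α) = sup_{β > 0} inf_{τ > 0} βτ/(2δ) + L(α, τ/β) - αβ/δ`, the supremum and the
infimum being taken in the extended reals. -/
noncomputable def potential (δ α : ℝ) : EReal :=
  ⨆ (β : ℝ) (_ : 0 < β), ⨅ (τ : ℝ) (_ : 0 < τ),
    ((β * τ / (2 * δ) + envL P G Z loss α (τ / β) - α * β / δ : ℝ) : EReal)

/-- The threshold `1 / (1 - inf_{t > 0} E[dist(G, t ∂loss(Z))²])₊` in `[0, ∞]`. Subtraction of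
extended nonnegative reals is truncated at `0`, which gives the positive part, and `0⁻¹ = ∞`. -/
noncomputable def deltaPerfect : ℝ≥0∞ :=
  (1 - ⨅ (t : ℝ) (_ : 0 < t),
    ∫⁻ ω, ENNReal.ofReal (Metric.infDist (G ω) (t • subdiff loss (Z ω)) ^ 2) ∂P)⁻¹

/-- The residual `(αG + Z) - prox[κ loss](αG + Z)`. -/
noncomputable def proxResidual (α κ : ℝ) (ω : Ω) : ℝ :=
  (α * G ω + Z ω) - prox (fun u => κ * loss u) (α * G ω + Z ω)

/-- The system of two equations in the unknowns `(α, κ)`. -/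
def SolvesSystem (δ α κ : ℝ) : Prop :=
  α ^ 2 = δ * ∫ ω, proxResidual G Z loss α κ ω ^ 2 ∂P ∧
    α = δ * ∫ ω, proxResidual G Z loss α κ ω * G ω ∂P

end Potential

/-! Write `R` for the proximal residual at `(α, κ)`. For `α > 0` there is a `κ = k α` on the curve
`α² = δ E[R²]`, by the intermediate value theorem: `E[R²]` is small for small `κ` and eventually
exceeds any number below `α²`, in particular `α² / δ` because `δ > 1`. On the curve the sup-inf has
a saddle point at `τ = α`, `β = α / κ`, so the potential equals the excess risk `m α = E[loss(Z + αG
- R) - loss(Z)]` (`potential_eq`). This is the least value of `E[loss(Z + αG - S) - loss(Z)]` over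
square-integrable `S` with `E[S²] ≤ α² / δ`. The subgradient inequality at the proximal point plus
Cauchy–Schwarz gives `m` the slope `(E[R G] - α / δ) / κ` (`excessRisk_add_le`).

Existence: slopes are bounded, `m 0 = 0`, and `m` is positive somewhere (`exists_excessRisk_pos`). A
positive minimizer has zero slope, which is the second equation (`solvesSystem_of_minimizer`).
Uniqueness is rigidity (`eq_of_excessRisk_le`): equality in Cauchy–Schwarz and in the subgradient
inequality, extended by the full support of the Gaussian to every signal value, forces equal `α`.
Strict monotonicity of `E[R²]` in `κ` then determines `κ`.

Threshold: if the minimizer is `0`, all slopes are nonnegative. Rescaling the displacement by `1 /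
κ` and letting `α → 0`, Fatou's lemma yields a `t` that shows `δ` is at least the threshold
(`deltaPerfect_le_of_slope_nonneg`). -/

/-- A convex, Lipschitz function on the line whose only minimizer is `0`. -/
structure RobustLoss (f : ℝ → ℝ) (K : ℝ) : Prop where
  convex : ConvexOn ℝ Set.univ f
  lip : ∀ x y, |f x - f y| ≤ K * |x - y|
  pos : 0 < K
  argmin : argminSet f = {0}

/-! ### Convex analysis on the line: subgradients, proximal map, Moreau envelope. -/

lemma subdiff_mono {f : ℝ → ℝ} {x y s t : ℝ} (hs : s ∈ subdiff f x) (ht : t ∈ subdiff f y) :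
    0 ≤ (s - t) * (x - y) := by
  have h1 := hs y
  have h2 := ht x
  nlinarith

namespace RobustLoss

variable {f : ℝ → ℝ} {K : ℝ} (hf : RobustLoss f K)
include hf

lemma min_le (x : ℝ) : f 0 ≤ f x := by
  have : (0 : ℝ) ∈ argminSet f := by rw [hf.argmin]; rfl
  exact this x

lemma eq_zero_of_le {x : ℝ} (hx : f x ≤ f 0) : x = 0 := by
  have : x ∈ argminSet f := fun y => hx.trans (hf.min_le y)
  rwa [hf.argmin] at this

lemma eq_zero_of_zero_mem_subdiff {x : ℝ} (hx : 0 ∈ subdiff f x) : x = 0 := by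
  apply hf.eq_zero_of_le
  simpa using hx 0

lemma continuous : Continuous f := by
  have : LipschitzWith (Real.toNNReal K) f := LipschitzWith.of_dist_le_mul fun x y => by
    rw [Real.coe_toNNReal _ hf.pos.le, Real.dist_eq, Real.dist_eq]
    exact hf.lip x y
  exact this.continuous

lemma abs_le_of_mem_subdiff {x s : ℝ} (hs : s ∈ subdiff f x) : |s| ≤ K := by
  have h1 := hs (x + 1)
  have h2 := hs (x - 1)
  have h3 := (abs_le.1 (hf.lip (x + 1) x)).2
  have h4 := (abs_le.1 (hf.lip (x - 1) x)).2
  have e1 : |x + 1 - x| = 1 := by norm_num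
  have e2 : |x - 1 - x| = 1 := by norm_num
  rw [e1] at h3
  rw [e2] at h4
  rw [abs_le]
  constructor <;> linarith

lemma exists_prox {κ : ℝ} (hκ : 0 < κ) (x : ℝ) :
    ∃ u, u ∈ argminSet fun w => κ * f w + (x - w) ^ 2 / 2 := by
  have hc : Continuous fun w => κ * f w + (x - w) ^ 2 / 2 := by
    have := hf.continuous
    fun_prop
  have hlim : Filter.Tendsto (fun w => κ * f w + (x - w) ^ 2 / 2) (Filter.cocompact ℝ)
      Filter.atTop := by
    have h1 : Filter.Tendsto (fun w : ℝ => ‖w - x‖) (Filter.cocompact ℝ) Filter.atTop :=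
      tendsto_norm_cocompact_atTop.comp
        (Homeomorph.subRight x).isClosedEmbedding.tendsto_cocompact
    refine Filter.tendsto_atTop_mono (f := fun w => (κ * f 0 - 1) + ‖w - x‖) (fun w => ?_)
      (Filter.tendsto_atTop_add_const_left _ _ h1)
    have h2 := mul_le_mul_of_nonneg_left (hf.min_le w) hκ.le
    have h3 : (x - w) ^ 2 = |w - x| ^ 2 := by rw [sq_abs]; ring
    rw [Real.norm_eq_abs, h3]
    nlinarith [sq_nonneg (|w - x| - 1)]
  obtain ⟨u, hu⟩ := hc.exists_forall_le hlim
  exact ⟨u, hu⟩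

/-- Fermat's rule: compare `u` with points of the segment towards `y`, divide by the step `t`, and
let `t → 0`. -/
lemma mem_subdiff_of_mem_argminSet {κ : ℝ} (hκ : 0 < κ) {x u : ℝ}
    (hu : u ∈ argminSet fun w => κ * f w + (x - w) ^ 2 / 2) : (x - u) / κ ∈ subdiff f u := by
  intro y
  have key : ∀ t : ℝ, 0 < t → t ≤ 1 →
      (x - u) * (y - u) - t * (y - u) ^ 2 / 2 ≤ κ * (f y - f u) := by
    intro t ht ht1
    have h1 := hu ((1 - t) * u + t * y)
    have h2 := hf.convex.2 (Set.mem_univ u) (Set.mem_univ y) (sub_nonneg.2 ht1) ht.le (by ring)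
    simp only [smul_eq_mul] at h1 h2
    have h3 := mul_le_mul_of_nonneg_left h2 hκ.le
    have h4 : 0 ≤ t * (κ * (f y - f u) - ((x - u) * (y - u) - t * (y - u) ^ 2 / 2)) := by
      nlinarith
    have := nonneg_of_mul_nonneg_right h4 ht
    linarith
  have hlim : (x - u) * (y - u) ≤ κ * (f y - f u) := by
    apply le_of_forall_pos_le_add
    intro ε hε
    have hd : 0 < (y - u) ^ 2 / 2 + 1 := by positivity
    have h5 := key (min 1 (ε / ((y - u) ^ 2 / 2 + 1))) (by positivity) (min_le_left _ _)
    have h6 : min 1 (ε / ((y - u) ^ 2 / 2 + 1)) * ((y - u) ^ 2 / 2 + 1) ≤ ε := by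
      rw [← le_div_iff₀ hd]
      exact min_le_right _ _
    have h7 : 0 < min 1 (ε / ((y - u) ^ 2 / 2 + 1)) := by positivity
    nlinarith
  have : (x - u) / κ * (y - u) ≤ f y - f u := by
    rw [div_mul_eq_mul_div, div_le_iff₀ hκ]
    linarith
  linarith

lemma prox_mem_subdiff {κ : ℝ} (hκ : 0 < κ) (x : ℝ) :
    (x - prox (fun u => κ * f u) x) / κ ∈ subdiff f (prox (fun u => κ * f u) x) :=
  hf.mem_subdiff_of_mem_argminSet hκ (Classical.epsilon_spec (hf.exists_prox hκ x))

/-- Pair `x - x' = (u - u') + κ'(g - g') + (κ - κ')g` with `u - u'`: the middle term is nonnegative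
by monotonicity and `|g| ≤ K`. Joint continuity in `(κ, x)` follows. -/
lemma abs_prox_sub_le {κ κ' : ℝ} (hκ : 0 < κ) (hκ' : 0 < κ') (x x' : ℝ) :
    |prox (fun u => κ * f u) x - prox (fun u => κ' * f u) x'| ≤ |x - x'| + |κ - κ'| * K := by
  set u := prox (fun u => κ * f u) x with hu
  set u' := prox (fun u => κ' * f u) x' with hu'
  have h := hf.prox_mem_subdiff hκ x
  have h' := hf.prox_mem_subdiff hκ' x'
  rw [← hu] at h
  rw [← hu'] at h'
  set g := (x - u) / κ with hg
  set g' := (x' - u') / κ' with hg'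
  have e : x = u + κ * g := by rw [hg]; field_simp; ring
  have e' : x' = u' + κ' * g' := by rw [hg']; field_simp; ring
  have hm := subdiff_mono h h'
  have hb := hf.abs_le_of_mem_subdiff h
  have h1 : (u - u') ^ 2 ≤ (x - x') * (u - u') + (κ' - κ) * g * (u - u') := by
    rw [e, e']
    nlinarith [mul_nonneg hκ'.le hm]
  have h2 : (x - x') * (u - u') ≤ |x - x'| * |u - u'| := by
    rw [← abs_mul]; exact le_abs_self _
  have h3 : (κ' - κ) * g * (u - u') ≤ |κ - κ'| * K * |u - u'| := by
    refine (le_abs_self _).trans ?_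
    rw [abs_mul, abs_mul, abs_sub_comm κ' κ]
    gcongr
  rcases eq_or_lt_of_le (abs_nonneg (u - u')) with h0 | h0
  · rw [← h0]
    have := hf.pos
    positivity
  · rw [← sq_abs] at h1
    nlinarith

lemma prox_eq_of_mem {κ : ℝ} (hκ : 0 < κ) {x u : ℝ} (hu : (x - u) / κ ∈ subdiff f u) :
    prox (fun u => κ * f u) x = u := by
  set v := prox (fun u => κ * f u) x with hv
  have h := hf.prox_mem_subdiff hκ x
  rw [← hv] at h
  have hm := subdiff_mono h hu
  have e : (x - v) / κ - (x - u) / κ = -(v - u) / κ := by ring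
  rw [e, div_mul_eq_mul_div, le_div_iff₀ hκ] at hm
  have : (v - u) ^ 2 ≤ 0 := by nlinarith
  have := pow_eq_zero_iff (two_ne_zero) |>.1 (le_antisymm this (sq_nonneg _))
  linarith

lemma zero_mem_subdiff_zero : 0 ∈ subdiff f 0 := fun y => by simpa using hf.min_le y

lemma prox_zero {κ : ℝ} (hκ : 0 < κ) : prox (fun u => κ * f u) 0 = 0 :=
  hf.prox_eq_of_mem hκ (by simpa using hf.zero_mem_subdiff_zero)

lemma continuousOn_prox :
    ContinuousOn (fun p : ℝ × ℝ => prox (fun u => p.1 * f u) p.2) (Set.Ioi 0 ×ˢ Set.univ) := by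
  intro p hp
  have hp0 : 0 < p.1 := hp.1
  have hlim : Filter.Tendsto (fun q : ℝ × ℝ => |q.2 - p.2| + |q.1 - p.1| * K)
      (nhdsWithin p (Set.Ioi 0 ×ˢ Set.univ)) (nhds 0) := by
    have : Continuous (fun q : ℝ × ℝ => |q.2 - p.2| + |q.1 - p.1| * K) := by fun_prop
    have := (this.tendsto p).mono_left (nhdsWithin_le_nhds (s := Set.Ioi 0 ×ˢ Set.univ))
    simpa using this
  refine tendsto_iff_dist_tendsto_zero.2 (squeeze_zero' (Filter.Eventually.of_forall
    fun _ => dist_nonneg) ?_ hlim)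
  filter_upwards [self_mem_nhdsWithin] with q hq
  rw [Real.dist_eq]
  exact hf.abs_prox_sub_le hq.1 hp0 _ _

lemma continuous_prox {κ : ℝ} (hκ : 0 < κ) : Continuous (prox fun u => κ * f u) := by
  have := hf.continuousOn_prox.comp_continuous (f := fun x : ℝ => (κ, x)) (by fun_prop)
    (fun x => ⟨hκ, trivial⟩)
  exact this

lemma abs_sub_prox_le {κ : ℝ} (hκ : 0 < κ) (x : ℝ) :
    |x - prox (fun u => κ * f u) x| ≤ κ * K := by
  have h := hf.abs_le_of_mem_subdiff (hf.prox_mem_subdiff hκ x)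
  rwa [abs_div, abs_of_pos hκ, div_le_iff₀ hκ, mul_comm] at h

/-- Monotonicity of subgradients reads `κ' r² + κ r'² ≤ (κ + κ') r r'`; bounding `r r'` by the mean
of the squares leaves `(κ' - κ)(r'² - r²) ≥ 0`. -/
lemma sub_prox_sq_mono {κ κ' : ℝ} (hκ : 0 < κ) (h : κ ≤ κ') (x : ℝ) :
    (x - prox (fun u => κ * f u) x) ^ 2 ≤ (x - prox (fun u => κ' * f u) x) ^ 2 := by
  have hκ' : 0 < κ' := hκ.trans_le h
  have hm := subdiff_mono (hf.prox_mem_subdiff hκ x) (hf.prox_mem_subdiff hκ' x)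
  set r := x - prox (fun u => κ * f u) x with hr
  set r' := x - prox (fun u => κ' * f u) x with hr'
  have e : prox (fun u => κ * f u) x - prox (fun u => κ' * f u) x = r' - r := by
    rw [hr, hr']; ring
  have e2 : r / κ - r' / κ' = (κ' * r - κ * r') / (κ * κ') := by field_simp
  rw [e, e2, div_mul_eq_mul_div, le_div_iff₀ (by positivity), zero_mul] at hm
  rcases h.eq_or_lt with rfl | hlt'
  · exact le_rfl
  by_contra! hlt
  have h1 : r * r' ≤ (r ^ 2 + r' ^ 2) / 2 := by nlinarith [sq_nonneg (r - r')]
  nlinarith [mul_le_mul_of_nonneg_left h1 (by positivity : 0 ≤ κ + κ'),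
    mul_pos (sub_pos.2 hlt') (sub_pos.2 hlt)]

lemma moreauEnv_eq {κ : ℝ} (hκ : 0 < κ) (x : ℝ) :
    moreauEnv f x κ = (x - prox (fun u => κ * f u) x) ^ 2 / (2 * κ)
      + f (prox (fun u => κ * f u) x) := by
  have hmin : ∀ u, (x - prox (fun u => κ * f u) x) ^ 2 / (2 * κ) + f (prox (fun u => κ * f u) x)
      ≤ (x - u) ^ 2 / (2 * κ) + f u := by
    intro u
    have h := Classical.epsilon_spec (hf.exists_prox hκ x) u
    change κ * f (prox (fun u => κ * f u) x) + (x - prox (fun u => κ * f u) x) ^ 2 / 2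
      ≤ κ * f u + (x - u) ^ 2 / 2 at h
    have e : ∀ w, (x - w) ^ 2 / (2 * κ) + f w = (κ * f w + (x - w) ^ 2 / 2) / κ := by
      intro w; field_simp
      ring
    rw [e, e]
    gcongr
  refine le_antisymm (ciInf_le ⟨(x - prox (fun u => κ * f u) x) ^ 2 / (2 * κ)
      + f (prox (fun u => κ * f u) x), ?_⟩ _) (le_ciInf hmin)
  rintro _ ⟨u, rfl⟩
  exact hmin u

lemma moreauEnv_le {κ : ℝ} (hκ : 0 < κ) (x u : ℝ) :
    moreauEnv f x κ ≤ (x - u) ^ 2 / (2 * κ) + f u := by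
  refine ciInf_le ⟨f 0, ?_⟩ u
  rintro _ ⟨u, rfl⟩
  have := hf.min_le u
  have h : 0 ≤ (x - u) ^ 2 / (2 * κ) := by positivity
  simp only
  linarith

omit hf in
-- Replace `f` by its supporting line at `u` and minimize the resulting quadratic exactly.
lemma le_moreauEnv {κ : ℝ} (hκ : 0 < κ) {x u s : ℝ} (hs : s ∈ subdiff f u) :
    f u + s * (x - u) - κ * s ^ 2 / 2 ≤ moreauEnv f x κ := by
  refine le_ciInf fun w => ?_
  have h := hs w
  have h2 : s * (x - w) - κ * s ^ 2 / 2 ≤ (x - w) ^ 2 / (2 * κ) := by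
    rw [le_div_iff₀ (by positivity)]
    nlinarith [sq_nonneg (x - w - κ * s)]
  linarith

lemma le_interpolation (x : ℝ) {t : ℝ} (h0 : 0 ≤ t) (h1 : t ≤ 1) :
    f (t * x) ≤ (1 - t) * f 0 + t * f x := by
  have := hf.convex.2 (Set.mem_univ (0 : ℝ)) (Set.mem_univ x) (sub_nonneg.2 h1) h0 (by ring)
  simpa only [smul_eq_mul, mul_zero, zero_add] using this

/-- Uniqueness of the minimizer gives a gap at `±1`, which convexity propagates along rays from `0`;
the term `-c` absorbs `|x| ≤ 1`. -/
lemma linear_growth : ∃ c > 0, ∀ x, f 0 + c * |x| - c ≤ f x := by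
  set c := min (f 1) (f (-1)) - f 0 with hc
  have h1 : f 0 < f 1 := lt_of_not_ge fun h => one_ne_zero (hf.eq_zero_of_le h)
  have h2 : f 0 < f (-1) := lt_of_not_ge fun h => by
    have := hf.eq_zero_of_le h
    norm_num at this
  have hc0 : 0 < c := by rw [hc]; exact sub_pos.2 (lt_min h1 h2)
  have hc1 : c ≤ f 1 - f 0 := by rw [hc]; gcongr; exact min_le_left _ _
  have hc2 : c ≤ f (-1) - f 0 := by rw [hc]; gcongr; exact min_le_right _ _
  refine ⟨c, hc0, fun x => ?_⟩
  rcases le_or_gt |x| 1 with hx | hx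
  · have := hf.min_le x
    nlinarith
  have hx0 : 0 < |x| := by linarith
  have hconv := hf.le_interpolation x (t := |x|⁻¹) (by positivity) (inv_le_one_of_one_le₀ hx.le)
  have hval : f 0 + c ≤ f (|x|⁻¹ * x) := by
    rcases abs_choice x with h | h
    · have : |x|⁻¹ * x = 1 := by
        nth_rw 2 [← h]; exact inv_mul_cancel₀ hx0.ne'
      rw [this]; linarith
    · have : |x|⁻¹ * x = -1 := by
        have : x = -|x| := by linarith
        nth_rw 2 [this]; rw [mul_neg, inv_mul_cancel₀ hx0.ne']
      rw [this]; linarith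
  have h3 : c ≤ |x|⁻¹ * (f x - f 0) := by linarith
  rw [inv_mul_eq_div, le_div_iff₀ hx0] at h3
  linarith

lemma tendsto_zero_of_tendsto {ι : Type*} {l : Filter ι} {u : ι → ℝ}
    (h : Filter.Tendsto (fun i => f (u i)) l (nhds (f 0))) : Filter.Tendsto u l (nhds 0) := by
  rw [Metric.tendsto_nhds]
  intro ε hε
  have h1 : f 0 < f ε := lt_of_not_ge fun h => hε.ne' (hf.eq_zero_of_le h)
  have h2 : f 0 < f (-ε) := lt_of_not_ge fun h => by
    have := hf.eq_zero_of_le h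
    linarith
  filter_upwards [h.eventually_lt_const (lt_min h1 h2)] with i hi
  rw [Real.dist_eq, sub_zero]
  by_contra! hge
  have hx0 : 0 < |u i| := by linarith
  have hconv := hf.le_interpolation (u i) (t := ε / |u i|) (by positivity)
    (div_le_one_of_le₀ hge hx0.le)
  have hval : min (f ε) (f (-ε)) ≤ f (ε / |u i| * u i) := by
    rcases abs_choice (u i) with h | h
    · have : ε / |u i| * u i = ε := by
        nth_rw 2 [← h]; exact div_mul_cancel₀ _ hx0.ne'
      rw [this]; exact min_le_left _ _
    · have : ε / |u i| * u i = -ε := by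
        have : u i = -|u i| := by linarith
        nth_rw 2 [this]; rw [mul_neg, div_mul_cancel₀ _ hx0.ne']
      rw [this]; exact min_le_right _ _
  have h3 : 0 < ε / |u i| := by positivity
  have h4 : ε / |u i| ≤ 1 := div_le_one_of_le₀ hge hx0.le
  have h5 := hf.min_le (u i)
  nlinarith

/-- The envelope with competitor `0` bounds `f` at the proximal point by `f 0 + x² / (2κ)`. -/
lemma tendsto_prox_atTop (x : ℝ) :
    Filter.Tendsto (fun n : ℕ => prox (fun u => ((n : ℝ) + 1) * f u) x) Filter.atTop (nhds 0) := by
  apply hf.tendsto_zero_of_tendsto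
  have hlim : Filter.Tendsto (fun n : ℕ => f 0 + x ^ 2 / 2 * (1 / ((n : ℝ) + 1))) Filter.atTop
      (nhds (f 0)) := by
    have := (tendsto_one_div_add_atTop_nhds_zero_nat (𝕜 := ℝ)).const_mul (x ^ 2 / 2)
    simpa using this.const_add (f 0)
  refine tendsto_of_tendsto_of_tendsto_of_le_of_le tendsto_const_nhds hlim
    (fun n => hf.min_le _) fun n => ?_
  have hn : (0 : ℝ) < (n : ℝ) + 1 := by positivity
  have h1 := hf.moreauEnv_eq hn x
  have h2 := hf.moreauEnv_le hn x 0
  have h3 : 0 ≤ (x - prox (fun u => ((n : ℝ) + 1) * f u) x) ^ 2 / (2 * ((n : ℝ) + 1)) := by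
    positivity
  have h4 : (x - 0) ^ 2 / (2 * ((n : ℝ) + 1)) = x ^ 2 / 2 * (1 / ((n : ℝ) + 1)) := by
    field_simp
    ring
  simp only
  linarith

/-- If the two maps agreed, the subgradients at a fixed point would be stable under multiplication
by `κ' / κ > 1`; iterating on a nonzero one contradicts the bound `K`. -/
lemma exists_prox_ne {κ κ' : ℝ} (hκ : 0 < κ) (h : κ < κ') :
    ∃ x, prox (fun u => κ * f u) x ≠ prox (fun u => κ' * f u) x := by
  by_contra! heq
  have hκ' : 0 < κ' := hκ.trans h
  set u := prox (fun u => κ * f u) 1 with hu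
  set s := (1 - u) / κ with hs
  have hmem : s ∈ subdiff f u := hf.prox_mem_subdiff hκ 1
  have hs0 : s ≠ 0 := by
    intro h0
    rw [h0] at hmem
    have hu0 := hf.eq_zero_of_zero_mem_subdiff hmem
    rw [hs, hu0] at h0
    simp [hκ.ne'] at h0
  have hstep : ∀ t, t ∈ subdiff f u → κ' / κ * t ∈ subdiff f u := by
    intro t ht
    have h1 : prox (fun u => κ' * f u) (u + κ' * t) = u := by
      apply hf.prox_eq_of_mem hκ'
      have : (u + κ' * t - u) / κ' = t := by field_simp; ring
      rwa [this]
    have h2 := hf.prox_mem_subdiff hκ (u + κ' * t)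
    rw [heq, h1] at h2
    have : (u + κ' * t - u) / κ = κ' / κ * t := by field_simp; ring
    rwa [this] at h2
  have hpow : ∀ n : ℕ, (κ' / κ) ^ n * s ∈ subdiff f u := by
    intro n
    induction n with
    | zero => simpa using hmem
    | succ n ih =>
      rw [pow_succ', mul_assoc]
      exact hstep _ ih
  have h1 : 1 < κ' / κ := (one_lt_div hκ).2 h
  obtain ⟨n, hn⟩ := ((tendsto_pow_atTop_atTop_of_one_lt h1).eventually_gt_atTop (K / |s|)).exists
  have h2 := hf.abs_le_of_mem_subdiff (hpow n)
  rw [abs_mul, abs_of_pos (by positivity), ← le_div_iff₀ (abs_pos.2 hs0)] at h2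
  linarith

end RobustLoss

/-! ### The probabilistic model and its functionals. -/

/-- A standard Gaussian variable `G` and an independent random variable `Z`. -/
structure GaussianNoise {Ω : Type*} [MeasurableSpace Ω] (P : Measure Ω) (G Z : Ω → ℝ) : Prop where
  measurable_signal : Measurable G
  measurable_noise : Measurable Z
  law : P.map G = gaussianReal 0 1
  indep : IndepFun G Z P

section Functionals

variable {Ω : Type*} [MeasurableSpace Ω] (P : Measure Ω) (G Z : Ω → ℝ) (f : ℝ → ℝ)

/-- The excess risk `E[f(Z + w) - f(Z)]`. -/
noncomputable def excessRisk (w : Ω → ℝ) : ℝ := ∫ ω, (f (Z ω + w ω) - f (Z ω)) ∂P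

/-- The second moment of the proximal residual. -/
noncomputable def residualSq (α κ : ℝ) : ℝ := ∫ ω, proxResidual G Z f α κ ω ^ 2 ∂P

/-- The covariance of the proximal residual with the Gaussian signal. -/
noncomputable def residualCov (α κ : ℝ) : ℝ := ∫ ω, proxResidual G Z f α κ ω * G ω ∂P

end Functionals

section RiskAnalysis

variable {Ω : Type*} [MeasurableSpace Ω] {P : Measure Ω} [IsProbabilityMeasure P] {G Z : Ω → ℝ}
  {f : ℝ → ℝ} {K : ℝ}

omit [IsProbabilityMeasure P] in
lemma MeasureTheory.MemLp.integrable_mul_of_two {u v : Ω → ℝ} (hu : MemLp u 2 P)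
    (hv : MemLp v 2 P) : Integrable (fun ω => u ω * v ω) P :=
  hu.integrable_mul hv

omit [IsProbabilityMeasure P] in
lemma MeasureTheory.MemLp.integral_sq_add {u v : Ω → ℝ} (hu : MemLp u 2 P) (hv : MemLp v 2 P)
    (a b : ℝ) : ∫ ω, (a * u ω + b * v ω) ^ 2 ∂P
      = a ^ 2 * ∫ ω, u ω ^ 2 ∂P + 2 * a * b * ∫ ω, u ω * v ω ∂P + b ^ 2 * ∫ ω, v ω ^ 2 ∂P := by
  have e : ∀ ω, (a * u ω + b * v ω) ^ 2
      = a ^ 2 * u ω ^ 2 + 2 * a * b * (u ω * v ω) + b ^ 2 * v ω ^ 2 := fun ω => by ring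
  have h1 := hu.integrable_sq.const_mul (a ^ 2)
  have h2 := (hu.integrable_mul_of_two hv).const_mul (2 * a * b)
  have h3 := hv.integrable_sq.const_mul (b ^ 2)
  simp_rw [e]
  rw [integral_add (f := fun ω => a ^ 2 * u ω ^ 2 + 2 * a * b * (u ω * v ω)) (h1.add h2) h3,
    integral_add h1 h2, integral_const_mul, integral_const_mul, integral_const_mul]

namespace GaussianNoise

variable (hM : GaussianNoise P G Z)
include hM

omit [IsProbabilityMeasure P] in
lemma memLp : MemLp G 2 P := by
  have h := memLp_id_gaussianReal (μ := 0) (v := 1) 2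
  rw [← hM.law] at h
  have := (memLp_map_measure_iff (by fun_prop) hM.measurable_signal.aemeasurable).1 h
  exact this

omit [IsProbabilityMeasure P] in
lemma integral_signal : ∫ ω, G ω ∂P = 0 := by
  have h := integral_map (μ := P) hM.measurable_signal.aemeasurable (f := fun x : ℝ => x)
    (by fun_prop)
  rw [hM.law, integral_id_gaussianReal] at h
  exact h.symm

omit [IsProbabilityMeasure P] in
lemma integral_signal_sq : ∫ ω, G ω ^ 2 ∂P = 1 := by
  have h := integral_map (μ := P) hM.measurable_signal.aemeasurable (f := fun x : ℝ => x ^ 2)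
    (by fun_prop)
  rw [hM.law] at h
  have h2 := variance_eq_sub (memLp_id_gaussianReal (μ := 0) (v := 1) 2)
  rw [variance_id_gaussianReal] at h2
  simp only [Pi.pow_apply, id, integral_id_gaussianReal] at h2
  rw [← h]
  simpa using h2.symm

/-- By independence and Fubini, almost every slice vanishes Gaussian-a.e., hence Lebesgue-a.e.,
hence everywhere by continuity. -/
lemma forall_eq_zero_of_ae {h : ℝ → ℝ → ℝ} (hc : Continuous fun p : ℝ × ℝ => h p.1 p.2)
    (h0 : ∀ᵐ ω ∂P, h (G ω) (Z ω) = 0) : ∀ᵐ ω ∂P, ∀ t, h t (Z ω) = 0 := by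
  have hprod := (indepFun_iff_map_prod_eq_prod_map_map hM.measurable_noise.aemeasurable
    hM.measurable_signal.aemeasurable).1 hM.indep.symm
  have hmeas : MeasurableSet {p : ℝ × ℝ | h p.2 p.1 = 0} := by
    have : Continuous fun p : ℝ × ℝ => h p.2 p.1 := hc.comp continuous_swap
    exact (isClosed_eq this continuous_const).measurableSet
  have h1 : ∀ᵐ p ∂(P.map fun ω => (Z ω, G ω)), h p.2 p.1 = 0 := by
    rw [ae_map_iff (hM.measurable_noise.prodMk hM.measurable_signal).aemeasurable hmeas]
    exact h0
  rw [hprod, hM.law] at h1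
  have h2 := Measure.ae_ae_of_ae_prod h1
  refine ae_of_ae_map (p := fun z => ∀ t, h t z = 0) hM.measurable_noise.aemeasurable ?_
  filter_upwards [h2] with z hz
  have h3 : (fun t => h t z) =ᵐ[volume] fun _ => (0 : ℝ) :=
    (gaussianReal_absolutelyContinuous' 0 one_ne_zero).ae_le hz
  have h4 : Continuous fun t => h t z := hc.comp (by fun_prop : Continuous fun t : ℝ => (t, z))
  exact fun t => congrFun (Measure.eq_of_ae_eq h3 h4 continuous_const) t

lemma exists_forall_eq_zero {h : ℝ → ℝ → ℝ} (hc : Continuous fun p : ℝ × ℝ => h p.1 p.2)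
    (h0 : ∀ᵐ ω ∂P, h (G ω) (Z ω) = 0) (hZ : 0 < P {ω | Z ω ≠ 0}) :
    ∃ z ≠ 0, ∀ t, h t z = 0 := by
  have h1 := hM.forall_eq_zero_of_ae hc h0
  have h2 : ∃ᵐ ω ∂P, Z ω ≠ 0 := by
    rw [frequently_ae_iff]
    exact hZ.ne'
  obtain ⟨ω, hω, hω'⟩ := (h2.and_eventually h1).exists
  exact ⟨Z ω, hω, hω'⟩

end GaussianNoise

/-! ### Moments of the residual as functions of `(α, κ)`. -/

namespace RobustLoss

variable (hf : RobustLoss f K) (hM : GaussianNoise P G Z)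
include hf

omit [IsProbabilityMeasure P] in
lemma integrable_excess (hZ : Measurable Z) {w : Ω → ℝ} (hw : Integrable w P) :
    Integrable (fun ω => f (Z ω + w ω) - f (Z ω)) P := by
  have hc := hf.continuous
  refine (hw.const_mul K).mono ?_ (Filter.Eventually.of_forall fun ω => ?_)
  · exact (hc.comp_aestronglyMeasurable (hZ.aestronglyMeasurable.add hw.1)).sub
      (hc.measurable.comp hZ).aestronglyMeasurable
  · have := hf.lip (Z ω + w ω) (Z ω)
    rw [add_sub_cancel_left] at this
    rw [Real.norm_eq_abs, Real.norm_eq_abs, abs_mul, abs_of_pos hf.pos]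
    exact this

omit [IsProbabilityMeasure P] in
lemma abs_excessRisk_le (hZ : Measurable Z) {w : Ω → ℝ} (hw : Integrable w P) :
    |excessRisk P Z f w| ≤ K * ∫ ω, |w ω| ∂P := by
  rw [excessRisk, ← integral_const_mul]
  refine (abs_integral_le_integral_abs).trans (integral_mono (hf.integrable_excess hZ hw).abs
    (hw.abs.const_mul K) fun ω => ?_)
  have := hf.lip (Z ω + w ω) (Z ω)
  rwa [add_sub_cancel_left] at this

include hM

omit [IsProbabilityMeasure P] in
lemma measurable_proxResidual (α : ℝ) {κ : ℝ} (hκ : 0 < κ) :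
    Measurable (proxResidual G Z f α κ) := by
  have h1 : Measurable fun ω => α * G ω + Z ω :=
    (hM.measurable_signal.const_mul α).add hM.measurable_noise
  exact h1.sub ((hf.continuous_prox hκ).measurable.comp h1)

omit hM [MeasurableSpace Ω] in
lemma abs_proxResidual_le (α : ℝ) {κ : ℝ} (hκ : 0 < κ) (ω : Ω) :
    |proxResidual G Z f α κ ω| ≤ κ * K := hf.abs_sub_prox_le hκ _

lemma memLp_proxResidual (α : ℝ) {κ : ℝ} (hκ : 0 < κ) : MemLp (proxResidual G Z f α κ) 2 P :=
  MemLp.of_bound (hf.measurable_proxResidual hM α hκ).aestronglyMeasurable (κ * K)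
    (Filter.Eventually.of_forall fun ω => hf.abs_proxResidual_le α hκ ω)

lemma residualSq_mono (α : ℝ) {κ κ' : ℝ} (hκ : 0 < κ) (h : κ ≤ κ') :
    residualSq P G Z f α κ ≤ residualSq P G Z f α κ' :=
  integral_mono (hf.memLp_proxResidual hM α hκ).integrable_sq
    (hf.memLp_proxResidual hM α (hκ.trans_le h)).integrable_sq
    fun _ => hf.sub_prox_sq_mono hκ h _

omit hM [MeasurableSpace Ω] in
lemma proxResidual_div_mem (α : ℝ) {κ : ℝ} (hκ : 0 < κ) (ω : Ω) :
    proxResidual G Z f α κ ω / κ ∈ subdiff f (Z ω + (α * G ω - proxResidual G Z f α κ ω)) := by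
  have h := hf.prox_mem_subdiff hκ (α * G ω + Z ω)
  have e : Z ω + (α * G ω - proxResidual G Z f α κ ω)
      = prox (fun u => κ * f u) (α * G ω + Z ω) := by
    rw [proxResidual]; ring
  rw [e]
  exact h

/-- Equality of second moments forces `R = R'` almost surely. As `α > 0`, the argument `αt + z`
sweeps the whole line, so the proximal maps would coincide, contrary to `exists_prox_ne`. -/
lemma residualSq_strictMono (α : ℝ) {κ κ' : ℝ} (hκ : 0 < κ) (h : κ < κ')
    (hZ : 0 < P {ω | Z ω ≠ 0}) (hα : 0 < α) :
    residualSq P G Z f α κ < residualSq P G Z f α κ' := by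
  refine lt_of_le_of_ne (hf.residualSq_mono hM α hκ h.le) fun heq => ?_
  have hκ' := hκ.trans h
  set R := proxResidual G Z f α κ with hR
  set R' := proxResidual G Z f α κ' with hR'
  have hL : MemLp R 2 P := hf.memLp_proxResidual hM α hκ
  have hL' : MemLp R' 2 P := hf.memLp_proxResidual hM α hκ'
  have hint : ∫ ω, (R ω - R' ω) ^ 2 ∂P ≤ 0 := by
    have hpt : ∀ ω, (κ + κ') / 2 * (R ω - R' ω) ^ 2 ≤ (κ - κ') / 2 * (R ω ^ 2 - R' ω ^ 2) := by
      intro ω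
      have hm := subdiff_mono (hf.proxResidual_div_mem (G := G) (Z := Z) α hκ ω)
        (hf.proxResidual_div_mem (G := G) (Z := Z) α hκ' ω)
      rw [← hR, ← hR'] at hm
      have e : R ω / κ - R' ω / κ' = (κ' * R ω - κ * R' ω) / (κ * κ') := by field_simp
      rw [e, div_mul_eq_mul_div, le_div_iff₀ (by positivity)] at hm
      nlinarith
    have h1 := integral_mono ((hL.sub hL').integrable_sq.const_mul ((κ + κ') / 2))
      ((hL.integrable_sq.sub hL'.integrable_sq).const_mul ((κ - κ') / 2)) hpt
    simp only [Pi.sub_apply] at h1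
    rw [integral_const_mul, integral_const_mul, integral_sub hL.integrable_sq hL'.integrable_sq]
      at h1
    rw [residualSq, residualSq] at heq
    rw [← hR, ← hR'] at heq
    rw [heq, sub_self, mul_zero] at h1
    nlinarith
  have hae : (fun ω => (R ω - R' ω) ^ 2) =ᵐ[P] 0 :=
    (integral_eq_zero_iff_of_nonneg (fun ω => sq_nonneg _) (hL.sub hL').integrable_sq).1
      (le_antisymm hint (integral_nonneg fun ω => sq_nonneg _))
  have hc := hf.continuous_prox hκ
  have hc' := hf.continuous_prox hκ'
  obtain ⟨z, -, hz⟩ := hM.exists_forall_eq_zero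
    (h := fun t z => prox (fun u => κ * f u) (α * t + z) - prox (fun u => κ' * f u) (α * t + z))
    (by fun_prop) (by
      filter_upwards [hae] with ω hω
      have h1 : R ω - R' ω = 0 := by simpa using hω
      rw [hR, hR', proxResidual, proxResidual] at h1
      linarith) hZ
  obtain ⟨x, hx⟩ := hf.exists_prox_ne hκ h
  apply hx
  have := hz ((x - z) / α)
  have e : α * ((x - z) / α) + z = x := by field_simp; ring
  rw [e] at this
  linarith

omit hM [MeasurableSpace Ω] in
lemma continuousAt_proxResidual {p : ℝ × ℝ} (hp : 0 < p.2) (ω : Ω) :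
    ContinuousAt (fun p : ℝ × ℝ => proxResidual G Z f p.1 p.2 ω) p := by
  have h1 : ContinuousAt (fun q : ℝ × ℝ => prox (fun u => q.1 * f u) q.2)
      (p.2, p.1 * G ω + Z ω) :=
    hf.continuousOn_prox.continuousAt ((isOpen_Ioi.prod isOpen_univ).mem_nhds ⟨hp, trivial⟩)
  have h2 : ContinuousAt (fun p : ℝ × ℝ => (p.2, p.1 * G ω + Z ω)) p := by fun_prop
  have h3 : ContinuousAt (fun p : ℝ × ℝ => p.1 * G ω + Z ω) p := by fun_prop
  exact h3.sub (ContinuousAt.comp (f := fun p : ℝ × ℝ => (p.2, p.1 * G ω + Z ω)) h1 h2)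

lemma continuousAt_residualSq {p : ℝ × ℝ} (hp : 0 < p.2) :
    ContinuousAt (fun p : ℝ × ℝ => residualSq P G Z f p.1 p.2) p := by
  have hpos : ∀ᶠ q : ℝ × ℝ in nhds p, 0 < q.2 ∧ q.2 < p.2 + 1 :=
    (continuous_snd.tendsto p).eventually (Ioo_mem_nhds hp (lt_add_one _))
  refine continuousAt_of_dominated (bound := fun _ => ((p.2 + 1) * K) ^ 2) ?_ ?_
    (integrable_const _) (Filter.Eventually.of_forall fun ω =>
      (hf.continuousAt_proxResidual hp ω).pow 2)
  · filter_upwards [hpos] with q hq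
    exact ((hf.measurable_proxResidual hM q.1 hq.1).pow_const 2).aestronglyMeasurable
  · filter_upwards [hpos] with q hq
    refine Filter.Eventually.of_forall fun ω => ?_
    rw [Real.norm_eq_abs, abs_pow]
    have := hf.abs_proxResidual_le (G := G) (Z := Z) q.1 hq.1 ω
    have hK := hf.pos
    gcongr
    exact this.trans (by gcongr; exact hq.2.le)

lemma continuousAt_residualCov {p : ℝ × ℝ} (hp : 0 < p.2) :
    ContinuousAt (fun p : ℝ × ℝ => residualCov P G Z f p.1 p.2) p := by
  have hpos : ∀ᶠ q : ℝ × ℝ in nhds p, 0 < q.2 ∧ q.2 < p.2 + 1 :=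
    (continuous_snd.tendsto p).eventually (Ioo_mem_nhds hp (lt_add_one _))
  refine continuousAt_of_dominated (bound := fun ω => (p.2 + 1) * K * |G ω|) ?_ ?_
    ((hM.memLp.integrable one_le_two).abs.const_mul _) (Filter.Eventually.of_forall fun ω =>
      (hf.continuousAt_proxResidual hp ω).mul continuousAt_const)
  · filter_upwards [hpos] with q hq
    exact ((hf.measurable_proxResidual hM q.1 hq.1).mul hM.measurable_signal).aestronglyMeasurable
  · filter_upwards [hpos] with q hq
    refine Filter.Eventually.of_forall fun ω => ?_
    rw [Real.norm_eq_abs, abs_mul]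
    have := hf.abs_proxResidual_le (G := G) (Z := Z) q.1 hq.1 ω
    have hK := hf.pos
    gcongr
    exact this.trans (by gcongr; exact hq.2.le)

lemma residualSq_le (α : ℝ) {κ : ℝ} (hκ : 0 < κ) : residualSq P G Z f α κ ≤ (κ * K) ^ 2 := by
  have h := integral_mono (hf.memLp_proxResidual hM α hκ).integrable_sq
    (integrable_const ((κ * K) ^ 2)) fun ω => by
      have := hf.abs_proxResidual_le (G := G) (Z := Z) α hκ ω
      exact sq_le_sq' (abs_le.1 this).1 (abs_le.1 this).2
  simpa [residualSq] using h

/-- The residual's second moment eventually exceeds any number below `α²`. -/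
lemma exists_lt_residualSq (α : ℝ) {c : ℝ} (hc : c < α ^ 2) :
    ∃ κ, 0 < κ ∧ c < residualSq P G Z f α κ := by
  by_contra! hle
  have hbound : ∀ n : ℕ, ∫⁻ ω, ENNReal.ofReal (proxResidual G Z f α ((n : ℝ) + 1) ω ^ 2) ∂P
      ≤ ENNReal.ofReal c := by
    intro n
    have hn : (0 : ℝ) < (n : ℝ) + 1 := by positivity
    rw [← ofReal_integral_eq_lintegral_ofReal (hf.memLp_proxResidual hM α hn).integrable_sq
      (Filter.Eventually.of_forall fun ω => sq_nonneg _)]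
    exact ENNReal.ofReal_le_ofReal (hle _ hn)
  have hlim : ∀ ω, Filter.Tendsto (fun n : ℕ => ENNReal.ofReal
      (proxResidual G Z f α ((n : ℝ) + 1) ω ^ 2)) Filter.atTop
      (nhds (ENNReal.ofReal ((α * G ω + Z ω) ^ 2))) := by
    intro ω
    apply ENNReal.tendsto_ofReal
    have := ((hf.tendsto_prox_atTop (α * G ω + Z ω)).const_sub (α * G ω + Z ω)).pow 2
    rwa [sub_zero] at this
  have hY : Measurable fun ω => α * G ω + Z ω :=
    (hM.measurable_signal.const_mul α).add hM.measurable_noise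
  -- No moment of `Z` is assumed: Fatou turns the contradictory bound into square integrability of
  -- `αG + Z`, hence of `Z`. Independence then gives `α² + E[Z²] ≤ c`.
  have hfatou : ∫⁻ ω, ENNReal.ofReal ((α * G ω + Z ω) ^ 2) ∂P ≤ ENNReal.ofReal c := by
    calc ∫⁻ ω, ENNReal.ofReal ((α * G ω + Z ω) ^ 2) ∂P
        = ∫⁻ ω, Filter.liminf (fun n : ℕ => ENNReal.ofReal
            (proxResidual G Z f α ((n : ℝ) + 1) ω ^ 2)) Filter.atTop ∂P := by
          congr 1
          ext ω
          exact (hlim ω).liminf_eq.symm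
      _ ≤ _ := lintegral_liminf_le fun n =>
          ((hf.measurable_proxResidual hM α (by positivity)).pow_const 2).ennreal_ofReal
      _ ≤ ENNReal.ofReal c := by
          refine Filter.liminf_le_of_le (by isBoundedDefault) fun b hb => ?_
          obtain ⟨n, hn⟩ := hb.exists
          exact hn.trans (hbound n)
  have hYint : Integrable (fun ω => (α * G ω + Z ω) ^ 2) P := by
    refine ⟨(hY.pow_const 2).aestronglyMeasurable, ?_⟩
    rw [hasFiniteIntegral_iff_ofReal (Filter.Eventually.of_forall fun ω => sq_nonneg _)]
    exact hfatou.trans_lt ENNReal.ofReal_lt_top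
  have hYL : MemLp (fun ω => α * G ω + Z ω) 2 P :=
    (memLp_two_iff_integrable_sq hY.aestronglyMeasurable).2 hYint
  have hZL : MemLp Z 2 P := by
    have := hYL.sub (hM.memLp.const_mul α)
    refine this.congr_norm hM.measurable_noise.aestronglyMeasurable
      (Filter.Eventually.of_forall fun ω => ?_)
    simp
  have hGZ0 : ∫ ω, G ω * Z ω ∂P = 0 := by
    rw [hM.indep.integral_fun_mul_eq_mul_integral hM.measurable_signal.aestronglyMeasurable
      hM.measurable_noise.aestronglyMeasurable, hM.integral_signal, zero_mul]
  have hval : ∫ ω, (α * G ω + Z ω) ^ 2 ∂P = α ^ 2 + ∫ ω, Z ω ^ 2 ∂P := by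
    have := hM.memLp.integral_sq_add hZL α 1
    simpa [hGZ0, hM.integral_signal_sq] using this
  rw [← ofReal_integral_eq_lintegral_ofReal hYint
    (Filter.Eventually.of_forall fun ω => sq_nonneg _), hval] at hfatou
  have hZpos : 0 ≤ ∫ ω, Z ω ^ 2 ∂P := integral_nonneg fun ω => sq_nonneg _
  have hc0 : 0 ≤ c := by
    have := hle 1 one_pos
    exact (integral_nonneg fun ω => sq_nonneg _).trans this
  rw [ENNReal.ofReal_le_ofReal_iff hc0] at hfatou
  linarith

lemma exists_residualSq_eq {α c : ℝ} (hc0 : 0 < c) (hc : c < α ^ 2) :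
    ∃ κ, 0 < κ ∧ residualSq P G Z f α κ = c := by
  obtain ⟨b, hb, hcb⟩ := hf.exists_lt_residualSq hM α hc
  have hK := hf.pos
  -- Left endpoint for the intermediate value theorem, with `(aK)² ≤ c`.
  set a := min b (Real.sqrt c / K) with ha
  have ha0 : 0 < a := lt_min hb (div_pos (Real.sqrt_pos.2 hc0) hK)
  have hac : residualSq P G Z f α a ≤ c := by
    refine (hf.residualSq_le hM α ha0).trans ?_
    rw [← Real.sq_sqrt hc0.le]
    have : a * K ≤ Real.sqrt c := by
      rw [← le_div_iff₀ hK]; exact min_le_right _ _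
    gcongr
  have hcont : ContinuousOn (fun κ => residualSq P G Z f α κ) (Set.Icc a b) := by
    intro κ hκ
    have h1 := hf.continuousAt_residualSq hM (p := (α, κ)) (ha0.trans_le hκ.1)
    have h2 : ContinuousAt (fun κ : ℝ => (α, κ)) κ := by fun_prop
    exact (ContinuousAt.comp (f := fun κ : ℝ => (α, κ)) h1 h2).continuousWithinAt
  obtain ⟨κ, hκ, hκc⟩ := intermediate_value_Icc (min_le_left _ _) hcont ⟨hac, hcb.le⟩
  exact ⟨κ, ha0.trans_le hκ.1, hκc⟩

end RobustLoss

/-! ### The potential as an excess risk, and its subgradients. -/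

namespace RobustLoss

variable (hf : RobustLoss f K) (hM : GaussianNoise P G Z)
include hf hM

lemma memLp_displacement (α : ℝ) {κ : ℝ} (hκ : 0 < κ) :
    MemLp (fun ω => α * G ω - proxResidual G Z f α κ ω) 2 P :=
  (hM.memLp.const_mul α).sub (hf.memLp_proxResidual hM α hκ)

lemma integrable_excess_displacement (α : ℝ) {κ : ℝ} (hκ : 0 < κ) :
    Integrable (fun ω => f (Z ω + (α * G ω - proxResidual G Z f α κ ω)) - f (Z ω)) P :=
  hf.integrable_excess hM.measurable_noise
    ((hf.memLp_displacement hM α hκ).integrable one_le_two)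

omit hM [MeasurableSpace Ω] in
lemma moreauEnv_model (α : ℝ) {κ : ℝ} (hκ : 0 < κ) (ω : Ω) :
    moreauEnv f (α * G ω + Z ω) κ = 1 / (2 * κ) * proxResidual G Z f α κ ω ^ 2
      + f (Z ω + (α * G ω - proxResidual G Z f α κ ω)) := by
  have e : Z ω + (α * G ω - proxResidual G Z f α κ ω)
      = prox (fun u => κ * f u) (α * G ω + Z ω) := by
    rw [proxResidual]; ring
  rw [hf.moreauEnv_eq hκ, e, proxResidual]
  ring

lemma integrable_moreauEnv (α : ℝ) {κ : ℝ} (hκ : 0 < κ) :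
    Integrable (fun ω => moreauEnv f (α * G ω + Z ω) κ - f (Z ω)) P := by
  have h := ((hf.memLp_proxResidual hM α hκ).integrable_sq.const_mul (1 / (2 * κ))).add
    (hf.integrable_excess_displacement hM α hκ)
  refine h.congr (Filter.Eventually.of_forall fun ω => ?_)
  simp only [Pi.add_apply]
  rw [hf.moreauEnv_model α hκ]
  ring

/-- The proximal point for `κ` serves as competitor in the envelope for `κ'`. Together with
`le_envL`, where its subgradient serves as dual certificate, this gives the two halves of the saddle
point. -/
lemma envL_le (α : ℝ) {κ κ' : ℝ} (hκ : 0 < κ) (hκ' : 0 < κ') :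
    envL P G Z f α κ' ≤ excessRisk P Z f (fun ω => α * G ω - proxResidual G Z f α κ ω)
      + 1 / (2 * κ') * residualSq P G Z f α κ := by
  have h1 := hf.integrable_excess_displacement hM α hκ
  have h2 := (hf.memLp_proxResidual hM α hκ).integrable_sq.const_mul (1 / (2 * κ'))
  rw [envL, excessRisk, residualSq, ← integral_const_mul, ← integral_add h1 h2]
  refine integral_mono (hf.integrable_moreauEnv hM α hκ') (h1.add h2) fun ω => ?_
  have h := hf.moreauEnv_le hκ' (α * G ω + Z ω)
    (Z ω + (α * G ω - proxResidual G Z f α κ ω))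
  have e : (α * G ω + Z ω - (Z ω + (α * G ω - proxResidual G Z f α κ ω))) ^ 2 / (2 * κ')
      = 1 / (2 * κ') * proxResidual G Z f α κ ω ^ 2 := by ring
  rw [e] at h
  simp only
  linarith

lemma le_envL (α : ℝ) {κ κ' : ℝ} (hκ : 0 < κ) (hκ' : 0 < κ') :
    excessRisk P Z f (fun ω => α * G ω - proxResidual G Z f α κ ω)
      + (1 / κ - κ' / (2 * κ ^ 2)) * residualSq P G Z f α κ ≤ envL P G Z f α κ' := by
  have h1 := hf.integrable_excess_displacement hM α hκ
  have h2 := (hf.memLp_proxResidual hM α hκ).integrable_sq.const_mul (1 / κ - κ' / (2 * κ ^ 2))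
  rw [envL, excessRisk, residualSq, ← integral_const_mul, ← integral_add h1 h2]
  refine integral_mono (h1.add h2) (hf.integrable_moreauEnv hM α hκ') fun ω => ?_
  have h := le_moreauEnv (f := f) hκ' (x := α * G ω + Z ω) 
    (hf.proxResidual_div_mem (G := G) (Z := Z) α hκ ω)
  have e : proxResidual G Z f α κ ω / κ *
      (α * G ω + Z ω - (Z ω + (α * G ω - proxResidual G Z f α κ ω)))
      - κ' * (proxResidual G Z f α κ ω / κ) ^ 2 / 2
      = (1 / κ - κ' / (2 * κ ^ 2)) * proxResidual G Z f α κ ω ^ 2 := by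
    field_simp
    ring
  simp only
  linarith

/-- On the curve `α² = δ E[R²]` the potential is the excess risk of the proximal displacement. -/
lemma potential_eq {δ α κ : ℝ} (hδ : 0 < δ) (hα : 0 < α) (hκ : 0 < κ)
    (h : α ^ 2 = δ * residualSq P G Z f α κ) :
    potential P G Z f δ α
      = ((excessRisk P Z f fun ω => α * G ω - proxResidual G Z f α κ ω : ℝ) : EReal) := by
  have hρ : residualSq P G Z f α κ = α ^ 2 / δ := by rw [h]; field_simp
  apply le_antisymm
  -- With `τ = α`, all terms in `β` cancel.
  · refine iSup₂_le fun β hβ => iInf₂_le_of_le α hα ?_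
    rw [EReal.coe_le_coe_iff]
    have := hf.envL_le hM α hκ (div_pos hα hβ)
    rw [hρ] at this
    have e : 1 / (2 * (α / β)) * (α ^ 2 / δ) = α * β / δ - β * α / (2 * δ) := by
      field_simp
      ring
    linarith
  -- With `β = α / κ`, all terms in `τ` cancel.
  · refine le_iSup₂_of_le (α / κ) (div_pos hα hκ) (le_iInf₂ fun τ hτ => ?_)
    rw [EReal.coe_le_coe_iff]
    have := hf.le_envL hM α hκ (div_pos hτ (div_pos hα hκ))
    rw [hρ] at this
    have e : (1 / κ - τ / (α / κ) / (2 * κ ^ 2)) * (α ^ 2 / δ)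
        = α * (α / κ) / δ - α / κ * τ / (2 * δ) := by
      field_simp
    linarith

lemma potential_zero {δ : ℝ} (hδ : 0 < δ) : potential P G Z f δ 0 = ((0 : ℝ) : EReal) := by
  have hK := hf.pos
  apply le_antisymm
  · refine iSup₂_le fun β hβ => ?_
    rw [← EReal.le_of_forall_lt_iff_le]
    intro ε hε
    rw [EReal.coe_lt_coe_iff] at hε
    refine iInf₂_le_of_le (2 * δ * ε / β) (by positivity) ?_
    rw [EReal.coe_le_coe_iff]
    have hκ : 0 < 2 * δ * ε / β / β := by positivity
    have h1 : envL P G Z f 0 (2 * δ * ε / β / β) ≤ 0 := by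
      refine integral_nonpos fun ω => ?_
      have := hf.moreauEnv_le hκ (0 * G ω + Z ω) (Z ω)
      simp only [zero_mul, zero_add, sub_self] at this ⊢
      simp only [Pi.zero_apply]
      norm_num at this
      linarith
    have e : β * (2 * δ * ε / β) / (2 * δ) = ε := by field_simp
    rw [e]
    simp only [zero_mul, zero_div, sub_zero]
    linarith
  -- This `β` makes `βτ / (2δ)` equal to `κK² / 2`, the most that the envelope can lose for a
  -- `K`-Lipschitz loss.
  · refine le_iSup₂_of_le (K * Real.sqrt δ) (by positivity) (le_iInf₂ fun τ hτ => ?_)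
    rw [EReal.coe_le_coe_iff]
    set κ := τ / (K * Real.sqrt δ) with hκd
    have hκ : 0 < κ := by positivity
    have h1 : -(κ * K ^ 2 / 2) ≤ envL P G Z f 0 κ := by
      have := integral_mono (integrable_const (-(κ * K ^ 2 / 2)))
        (hf.integrable_moreauEnv hM 0 hκ) fun ω => by
          rw [hf.moreauEnv_model 0 hκ]
          have h2 := (abs_le.1 (hf.lip (Z ω + (0 * G ω - proxResidual G Z f 0 κ ω)) (Z ω))).1
          have e : Z ω + (0 * G ω - proxResidual G Z f 0 κ ω) - Z ω
              = -proxResidual G Z f 0 κ ω := by ring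
          rw [e, abs_neg] at h2
          have h3 : K * |proxResidual G Z f 0 κ ω| ≤
              1 / (2 * κ) * proxResidual G Z f 0 κ ω ^ 2 + κ * K ^ 2 / 2 := by
            rw [← sq_abs (proxResidual G Z f 0 κ ω)]
            have : 0 ≤ 1 / (2 * κ) * (|proxResidual G Z f 0 κ ω| - κ * K) ^ 2 := by positivity
            have e2 : 1 / (2 * κ) * (|proxResidual G Z f 0 κ ω| - κ * K) ^ 2
                = 1 / (2 * κ) * |proxResidual G Z f 0 κ ω| ^ 2
                  - K * |proxResidual G Z f 0 κ ω| + κ * K ^ 2 / 2 := by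
              field_simp
              ring
            linarith
          linarith
      simpa [envL] using this
    have e : K * Real.sqrt δ * τ / (2 * δ) = κ * K ^ 2 / 2 := by
      rw [hκd]
      have := Real.sq_sqrt hδ.le
      field_simp
      rw [this]
    rw [e]
    simp only [zero_mul, zero_div, sub_zero]
    linarith

omit hM [MeasurableSpace Ω] in
lemma bregman_nonneg (α : ℝ) {κ : ℝ} (hκ : 0 < κ) (w : Ω → ℝ) (ω : Ω) :
    0 ≤ f (Z ω + w ω) - f (Z ω + (α * G ω - proxResidual G Z f α κ ω))
      - proxResidual G Z f α κ ω / κ * (w ω - (α * G ω - proxResidual G Z f α κ ω)) := by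
  have h := hf.proxResidual_div_mem (G := G) (Z := Z) α hκ ω (Z ω + w ω)
  rw [add_sub_add_left_eq_sub] at h
  linarith

lemma integrable_bregman (α : ℝ) {κ : ℝ} (hκ : 0 < κ) {w : Ω → ℝ} (hw : MemLp w 2 P) :
    Integrable (fun ω => f (Z ω + w ω) - f (Z ω + (α * G ω - proxResidual G Z f α κ ω))
      - proxResidual G Z f α κ ω / κ * (w ω - (α * G ω - proxResidual G Z f α κ ω))) P := by
  have hR := hf.memLp_proxResidual hM α hκ
  have h1 := hf.integrable_excess_displacement hM α hκ
  have h2 := hf.integrable_excess hM.measurable_noise (hw.integrable one_le_two)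
  have h3 := (hR.integrable_mul_of_two (hw.sub (hf.memLp_displacement hM α hκ))).const_mul (1 / κ)
  refine ((h2.sub h1).sub h3).congr (Filter.Eventually.of_forall fun ω => ?_)
  simp only [Pi.sub_apply]
  ring

/-- The remainder in the subgradient inequality for the excess risk at the proximal
displacement. -/
lemma integral_bregman (α α' : ℝ) {κ : ℝ} (hκ : 0 < κ) {S : Ω → ℝ} (hS : MemLp S 2 P) :
    ∫ ω, (f (Z ω + (α' * G ω - S ω)) - f (Z ω + (α * G ω - proxResidual G Z f α κ ω))
      - proxResidual G Z f α κ ω / κ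
        * ((α' * G ω - S ω) - (α * G ω - proxResidual G Z f α κ ω))) ∂P
    = excessRisk P Z f (fun ω => α' * G ω - S ω)
      - excessRisk P Z f (fun ω => α * G ω - proxResidual G Z f α κ ω)
      - 1 / κ * ((α' - α) * residualCov P G Z f α κ
        - ∫ ω, proxResidual G Z f α κ ω * S ω ∂P + residualSq P G Z f α κ) := by
  have hR := hf.memLp_proxResidual hM α hκ
  have h0 : Integrable (fun ω => f (Z ω + (α' * G ω - S ω)) - f (Z ω)) P :=
    hf.integrable_excess hM.measurable_noise (((hM.memLp.const_mul α').sub hS).integrable one_le_two)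
  have h1 := hf.integrable_excess_displacement hM α hκ
  have h2 := (hR.integrable_mul_of_two hM.memLp).const_mul (α' - α)
  have h3 := hR.integrable_mul_of_two hS
  have h4 := hR.integrable_sq
  have h23 : Integrable (fun ω => (α' - α) * (proxResidual G Z f α κ ω * G ω)
    - proxResidual G Z f α κ ω * S ω) P := h2.sub h3
  have h234 : Integrable (fun ω => (α' - α) * (proxResidual G Z f α κ ω * G ω)
    - proxResidual G Z f α κ ω * S ω + proxResidual G Z f α κ ω ^ 2) P := h23.add h4
  have h01 : Integrable (fun ω => (f (Z ω + (α' * G ω - S ω)) - f (Z ω))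
    - (f (Z ω + (α * G ω - proxResidual G Z f α κ ω)) - f (Z ω))) P := h0.sub h1
  rw [excessRisk, excessRisk, residualCov, residualSq, ← integral_const_mul,
    ← integral_sub h2 h3, ← integral_add h23 h4, ← integral_const_mul,
    ← integral_sub h0 h1, ← integral_sub h01 (h234.const_mul _)]
  congr 1
  ext ω
  ring

/-- The subgradient inequality for the excess risk at the proximal displacement. -/
lemma le_excessRisk (α α' : ℝ) {κ : ℝ} (hκ : 0 < κ) {S : Ω → ℝ} (hS : MemLp S 2 P) :
    excessRisk P Z f (fun ω => α * G ω - proxResidual G Z f α κ ω)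
      + 1 / κ * ((α' - α) * residualCov P G Z f α κ
        - ∫ ω, proxResidual G Z f α κ ω * S ω ∂P + residualSq P G Z f α κ)
      ≤ excessRisk P Z f fun ω => α' * G ω - S ω := by
  have h : (0 : ℝ) ≤ _ := (integral_nonneg fun ω =>
    hf.bregman_nonneg (G := G) (Z := Z) α hκ (fun ω => α' * G ω - S ω) ω).trans_eq
      (hf.integral_bregman hM α α' hκ hS)
  linarith

omit [IsProbabilityMeasure P] hf hM in
lemma _root_.MeasureTheory.MemLp.integral_mul_le_of_sq_le {u v : Ω → ℝ} (hu : MemLp u 2 P)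
    (hv : MemLp v 2 P) {a b : ℝ} (ha : 0 < a) (hb : 0 ≤ b) (hua : ∫ ω, u ω ^ 2 ∂P ≤ a ^ 2)
    (hvb : ∫ ω, v ω ^ 2 ∂P ≤ b ^ 2) : ∫ ω, u ω * v ω ∂P ≤ a * b := by
  rcases hb.eq_or_lt with rfl | hb
  · have h1 : (fun ω => v ω ^ 2) =ᵐ[P] 0 :=
      (integral_eq_zero_iff_of_nonneg (fun _ => sq_nonneg _) hv.integrable_sq).1
        (le_antisymm (by simpa using hvb) (integral_nonneg fun _ => sq_nonneg _))
    rw [integral_eq_zero_of_ae, mul_zero]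
    filter_upwards [h1] with ω hω
    have : v ω = 0 := by simpa using hω
    simp [this]
  · have h := hu.integral_sq_add hv b (-a)
    have h0 : 0 ≤ ∫ ω, (b * u ω + -a * v ω) ^ 2 ∂P := integral_nonneg fun _ => sq_nonneg _
    have hab := mul_pos ha hb
    rw [h] at h0
    have h2 := mul_le_mul_of_nonneg_left hua (sq_nonneg b)
    have h3 := mul_le_mul_of_nonneg_left hvb (sq_nonneg a)
    by_contra! hlt
    nlinarith

lemma integral_proxResidual_mul_le {δ α α' κ : ℝ} (hδ : 0 < δ) (hα : 0 < α) (hα' : 0 ≤ α')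
    (hκ : 0 < κ) (h : α ^ 2 = δ * residualSq P G Z f α κ) {S : Ω → ℝ} (hS : MemLp S 2 P)
    (hSα : ∫ ω, S ω ^ 2 ∂P ≤ α' ^ 2 / δ) :
    ∫ ω, proxResidual G Z f α κ ω * S ω ∂P ≤ α * α' / δ := by
  have hρ : residualSq P G Z f α κ = α ^ 2 / δ := by rw [h]; field_simp
  have h2 := (hf.memLp_proxResidual hM α hκ).integral_mul_le_of_sq_le hS
    (a := α / Real.sqrt δ) (b := α' / Real.sqrt δ) (by positivity) (by positivity)
    (by rw [div_pow, Real.sq_sqrt hδ.le, ← hρ]; rfl)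
    (by rwa [div_pow, Real.sq_sqrt hδ.le])
  rwa [div_mul_div_comm, Real.mul_self_sqrt hδ.le] at h2

/-- The potential has the subgradient `(E[R G] - α / δ) / κ` along the curve `α² = δ E[R²]`. -/
lemma excessRisk_add_le {δ α α' κ : ℝ} (hδ : 0 < δ) (hα : 0 < α) (hα' : 0 ≤ α') (hκ : 0 < κ)
    (h : α ^ 2 = δ * residualSq P G Z f α κ) {S : Ω → ℝ} (hS : MemLp S 2 P)
    (hSα : ∫ ω, S ω ^ 2 ∂P ≤ α' ^ 2 / δ) :
    excessRisk P Z f (fun ω => α * G ω - proxResidual G Z f α κ ω)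
      + (residualCov P G Z f α κ - α / δ) / κ * (α' - α)
      ≤ excessRisk P Z f fun ω => α' * G ω - S ω := by
  have hρ : residualSq P G Z f α κ = α ^ 2 / δ := by rw [h]; field_simp
  have h1 := hf.le_excessRisk hM α α' hκ hS
  have h2 := hf.integral_proxResidual_mul_le hM hδ hα hα' hκ h hS hSα
  rw [hρ] at h1
  refine le_trans ?_ h1
  have h3 : (residualCov P G Z f α κ - α / δ) / κ * (α' - α)
      = 1 / κ * ((α' - α) * residualCov P G Z f α κ - α * α' / δ + α ^ 2 / δ) := by
    field_simp
    ring
  rw [h3]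
  gcongr

/-- Two ways to attain the same risk, one of them a solution of the system, have the same `α`. -/
lemma eq_of_excessRisk_le {δ α α' κ : ℝ} (hδ : 0 < δ) (hα : 0 < α) (hα' : 0 ≤ α') (hκ : 0 < κ)
    (hsol : SolvesSystem P G Z f δ α κ) (hZ : 0 < P {ω | Z ω ≠ 0}) {S : Ω → ℝ}
    (hS : MemLp S 2 P) (hSα : ∫ ω, S ω ^ 2 ∂P ≤ α' ^ 2 / δ)
    (hle : excessRisk P Z f (fun ω => α' * G ω - S ω)
      ≤ excessRisk P Z f fun ω => α * G ω - proxResidual G Z f α κ ω) : α' = α := by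
  obtain ⟨hs1, hs2⟩ := hsol
  have hR := hf.memLp_proxResidual hM α hκ
  have hρ : residualSq P G Z f α κ = α ^ 2 / δ := by rw [residualSq, hs1]; field_simp
  have hσ : residualCov P G Z f α κ = α / δ := by
    rw [residualCov, eq_div_iff hδ.ne', mul_comm]; exact hs2.symm
  have h1 := hf.le_excessRisk hM α α' hκ hS
  -- The reverse of Cauchy–Schwarz, so `S` is proportional to the residual.
  have h2 : α * α' / δ ≤ ∫ ω, proxResidual G Z f α κ ω * S ω ∂P := by
    have : 1 / κ * ((α' - α) * residualCov P G Z f α κ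
        - ∫ ω, proxResidual G Z f α κ ω * S ω ∂P + residualSq P G Z f α κ) ≤ 0 := by linarith
    have h3 := nonpos_of_mul_nonpos_right this (by positivity : 0 < 1 / κ)
    rw [hσ, hρ] at h3
    have e : (α' - α) * (α / δ) + α ^ 2 / δ = α * α' / δ := by ring
    linarith
  have hSR : ∀ᵐ ω ∂P, S ω = α' / α * proxResidual G Z f α κ ω := by
    have h4 := hR.integral_sq_add hS (α' / α) (-1)
    have h5 : ∫ ω, (α' / α * proxResidual G Z f α κ ω + -1 * S ω) ^ 2 ∂P ≤ 0 := by
      rw [h4]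
      have h6 : ∫ ω, proxResidual G Z f α κ ω ^ 2 ∂P = α ^ 2 / δ := hρ
      rw [h6]
      have h8 := mul_le_mul_of_nonneg_left h2 (div_nonneg hα' hα.le)
      have e1 : (α' / α) ^ 2 * (α ^ 2 / δ) = α' ^ 2 / δ := by field_simp
      have e2 : α' / α * (α * α' / δ) = α' ^ 2 / δ := by field_simp
      rw [e2] at h8
      rw [e1]
      linarith
    have h6 : (fun ω => (α' / α * proxResidual G Z f α κ ω + -1 * S ω) ^ 2) =ᵐ[P] 0 :=
      (integral_eq_zero_iff_of_nonneg (fun _ => sq_nonneg _)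
        ((hR.const_mul (α' / α)).add (hS.const_mul (-1))).integrable_sq).1
        (le_antisymm h5 (integral_nonneg fun _ => sq_nonneg _))
    filter_upwards [h6] with ω hω
    have : α' / α * proxResidual G Z f α κ ω + -1 * S ω = 0 := by
      simpa only [Pi.zero_apply, pow_eq_zero_iff two_ne_zero] using hω
    linarith
  have hgap := hf.integral_bregman hM α α' hκ hS
  have hCS := hf.integral_proxResidual_mul_le hM hδ hα hα' hκ hs1 hS hSα
  -- The nonnegative Bregman remainder has integral zero, so the subgradient inequality is an
  -- equality almost surely.
  have hgap0 := (integral_eq_zero_iff_of_nonneg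
    (hf.bregman_nonneg (G := G) (Z := Z) α hκ fun ω => α' * G ω - S ω)
    (hf.integrable_bregman hM α hκ ((hM.memLp.const_mul α').sub hS))).1 (by
      refine le_antisymm ?_ (integral_nonneg
        (hf.bregman_nonneg (G := G) (Z := Z) α hκ fun ω => α' * G ω - S ω))
      refine hgap.trans_le ?_
      rw [hσ, hρ]
      have e : (α' - α) * (α / δ) + α ^ 2 / δ = α * α' / δ := by ring
      have : 0 ≤ 1 / κ * ((α' - α) * (α / δ) - ∫ ω, proxResidual G Z f α κ ω * S ω ∂P
          + α ^ 2 / δ) := mul_nonneg (by positivity) (by linarith)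
      linarith)
  have hc := hf.continuous
  have hp := hf.continuous_prox hκ
  obtain ⟨z, hz, hz0⟩ := hM.exists_forall_eq_zero (h := fun t z =>
    f (z + α' / α * (prox (fun u => κ * f u) (α * t + z) - z))
      - f (prox (fun u => κ * f u) (α * t + z))
      - (α * t + z - prox (fun u => κ * f u) (α * t + z)) / κ
        * ((α' / α - 1) * (prox (fun u => κ * f u) (α * t + z) - z)))
    (by fun_prop) (by
      filter_upwards [hgap0, hSR] with ω h7 h8
      have e1 : α' * G ω - S ω
          = α' / α * (prox (fun u => κ * f u) (α * G ω + Z ω) - Z ω) := by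
        rw [h8, proxResidual]
        field_simp
        ring
      have e2 : α * G ω - proxResidual G Z f α κ ω
          = prox (fun u => κ * f u) (α * G ω + Z ω) - Z ω := by
        rw [proxResidual]; ring
      simp only [e1, e2, Pi.zero_apply] at h7
      rw [add_sub_cancel, proxResidual] at h7
      linarith) hZ
  -- At this signal the proximal point is `0`, and the equality becomes `f(z(1 - α'/α)) = f 0` with
  -- `z ≠ 0`.
  have h9 := hz0 (-z / α)
  have e : α * (-z / α) + z = 0 := by field_simp; ring
  simp only [e, hf.prox_zero hκ] at h9
  have h10 : f (z + α' / α * (0 - z)) - f 0 = 0 := by simpa using h9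
  have h11 := hf.eq_zero_of_le (sub_eq_zero.1 h10).le
  have h12 : z * (1 - α' / α) = 0 := by linarith
  have h13 := (mul_eq_zero.1 h12).resolve_left hz
  field_simp at h13
  linarith

end RobustLoss

/-! ### Existence of minimizers and limits of subgradients. -/

/-- A function on `[0, ∞)` with bounded subgradients at positive points that vanishes at `0` and is
positive somewhere attains its minimum. -/
lemma exists_forall_le_of_subgradient {m d : ℝ → ℝ} {C : ℝ}
    (hsub : ∀ a, 0 < a → ∀ b, 0 ≤ b → m a + d a * (b - a) ≤ m b)
    (hd : ∀ a, 0 < a → |d a| ≤ C) (h0 : m 0 = 0) (hlow : ∀ a, 0 < a → -(C * a) ≤ m a)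
    (hpos : ∃ a, 0 < a ∧ 0 < m a) : ∃ s, 0 ≤ s ∧ ∀ a, 0 ≤ a → m s ≤ m a := by
  have hstep : ∀ a, 0 < a → ∀ b, 0 ≤ b → m a - m b ≤ C * |a - b| := by
    intro a ha b hb
    have h1 := hsub a ha b hb
    have h2 : d a * (a - b) ≤ C * |a - b| := by
      refine (le_abs_self _).trans ?_
      rw [abs_mul]
      gcongr
      exact hd a ha
    linarith
  have hlip : ∀ a, 0 ≤ a → ∀ b, 0 ≤ b → m a - m b ≤ C * |a - b| := by
    intro a ha b hb
    rcases ha.eq_or_lt with rfl | ha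
    · rcases hb.eq_or_lt with rfl | hb
      · simp
      · have := hlow b hb
        rw [h0, zero_sub, zero_sub, abs_neg, abs_of_pos hb]
        linarith
    · exact hstep a ha b hb
  have hcont : ContinuousOn m (Set.Ici 0) := by
    intro a ha
    refine tendsto_iff_dist_tendsto_zero.2 (squeeze_zero' (Filter.Eventually.of_forall
      fun _ => dist_nonneg) (g := fun b => C * |b - a|) ?_ ?_)
    · filter_upwards [self_mem_nhdsWithin] with b hb
      rw [Real.dist_eq, abs_le]
      have h1 := hlip a ha b hb
      have h2 := hlip b hb a ha
      rw [abs_sub_comm] at h1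
      constructor <;> linarith
    · have : Continuous fun b => C * |b - a| := by fun_prop
      have := (this.tendsto a).mono_left (nhdsWithin_le_nhds (s := Set.Ici 0))
      simpa using this
  obtain ⟨a₁, ha₁, hm₁⟩ := hpos
  obtain ⟨s, hs, hmin⟩ := isCompact_Icc.exists_isMinOn (Set.nonempty_Icc.2 ha₁.le)
    (hcont.mono fun x hx => hx.1)
  -- Beyond `a₁` nothing lower occurs: the slope there is positive, since `m 0 = 0 < m a₁`.
  refine ⟨s, hs.1, fun a ha => ?_⟩
  rcases le_or_gt a a₁ with h | h
  · exact hmin ⟨ha, h⟩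
  · have h1 : m s ≤ m a₁ := hmin ⟨ha₁.le, le_rfl⟩
    have h2 := hsub a₁ ha₁ 0 le_rfl
    have h3 := hsub a₁ ha₁ a ha
    have h4 : 0 < d a₁ := by
      by_contra! hneg
      nlinarith
    nlinarith

namespace RobustLoss

variable (hf : RobustLoss f K)
include hf

lemma exists_subseq_tendsto_mem_subdiff {x g : ℕ → ℝ} {z : ℝ}
    (hx : Filter.Tendsto x Filter.atTop (nhds z)) (hg : ∀ n, g n ∈ subdiff f (x n)) :
    ∃ s ∈ subdiff f z, ∃ φ : ℕ → ℕ, StrictMono φ ∧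
      Filter.Tendsto (g ∘ φ) Filter.atTop (nhds s) := by
  obtain ⟨s, -, φ, hφ, hs⟩ := isCompact_Icc.tendsto_subseq (x := g) (s := Set.Icc (-K) K)
    fun n => abs_le.1 (hf.abs_le_of_mem_subdiff (hg n))
  refine ⟨s, fun y => ?_, φ, hφ, hs⟩
  have hxφ := hx.comp hφ.tendsto_atTop
  have h1 : Filter.Tendsto (fun n => f (x (φ n)) + g (φ n) * (y - x (φ n))) Filter.atTop
      (nhds (f z + s * (y - z))) :=
    ((hf.continuous.tendsto z).comp hxφ).add (hs.mul (hxφ.const_sub y))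
  exact le_of_tendsto' h1 fun n => hg (φ n) y

/-- The subgradients `g n` need not converge, but they are bounded and the subdifferential has
closed graph: a subsequence violating the bound would have a limit point in `subdiff f z` that is
too close. -/
lemma infDist_sq_le_liminf {x g b : ℕ → ℝ} {z ρ t : ℝ}
    (hx : Filter.Tendsto x Filter.atTop (nhds z)) (hg : ∀ n, g n ∈ subdiff f (x n))
    (hb : Filter.Tendsto b Filter.atTop (nhds ρ)) :
    ENNReal.ofReal (Metric.infDist (ρ * t) (subdiff f z) ^ 2)
      ≤ Filter.liminf (fun n => ENNReal.ofReal ((b n * t - g n) ^ 2)) Filter.atTop := by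
  rw [Filter.le_liminf_iff]
  intro y hy
  by_contra hcon
  rw [Filter.not_eventually] at hcon
  obtain ⟨ψ, hψ, hψy⟩ := Filter.extraction_of_frequently_atTop hcon
  obtain ⟨s, hs, φ, hφ, hlim⟩ := hf.exists_subseq_tendsto_mem_subdiff
    (hx.comp hψ.tendsto_atTop) fun n => hg (ψ n)
  have hb' := (hb.comp hψ.tendsto_atTop).comp hφ.tendsto_atTop
  have h1 := ENNReal.tendsto_ofReal (((hb'.mul_const t).sub hlim).pow 2)
  have h2 : ENNReal.ofReal ((ρ * t - s) ^ 2) ≤ y :=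
    le_of_tendsto' h1 fun n => not_lt.1 (hψy (φ n))
  have h3 : Metric.infDist (ρ * t) (subdiff f z) ≤ |ρ * t - s| := by
    have := Metric.infDist_le_dist_of_mem (x := ρ * t) hs
    rwa [Real.dist_eq] at this
  have h4 : ENNReal.ofReal (Metric.infDist (ρ * t) (subdiff f z) ^ 2)
      ≤ ENNReal.ofReal ((ρ * t - s) ^ 2) := by
    apply ENNReal.ofReal_le_ofReal
    rw [← sq_abs (ρ * t - s)]
    have := Metric.infDist_nonneg (x := ρ * t) (s := subdiff f z)
    gcongr
  exact absurd hy (not_lt.2 (h4.trans h2))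

omit hf in
lemma _root_.isClosed_subdiff (f : ℝ → ℝ) (x : ℝ) : IsClosed (subdiff f x) := by
  have : subdiff f x = ⋂ y, {s | f x + s * (y - x) ≤ f y} := by
    ext s
    simp [subdiff]
  rw [this]
  exact isClosed_iInter fun y => isClosed_le (by fun_prop) continuous_const

variable (hM : GaussianNoise P G Z)
include hM

omit [IsProbabilityMeasure P] hf in
lemma _root_.GaussianNoise.integral_abs_signal_le [IsProbabilityMeasure P] :
    ∫ ω, |G ω| ∂P ≤ 1 := by
  have h1 := hM.memLp.integrable one_le_two
  have h2 := integral_mono h1.abs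
    (((integrable_const (1 : ℝ)).add hM.memLp.integrable_sq).const_mul (1 / 2)) fun ω => by
      simp only [Pi.add_apply]
      rw [← sq_abs]
      nlinarith [sq_nonneg (|G ω| - 1)]
  simp only [Pi.add_apply] at h2
  rw [integral_const_mul, integral_add (integrable_const _) hM.memLp.integrable_sq,
    hM.integral_signal_sq] at h2
  simp at h2
  linarith

/-! ### Bounds along the curve `α² = δ E[R²]`. -/

variable {δ : ℝ} (hδ : 1 < δ)
include hδ

lemma exists_scale {α : ℝ} (hα : 0 < α) :
    ∃ κ, 0 < κ ∧ α ^ 2 = δ * residualSq P G Z f α κ := by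
  have hδ0 : 0 < δ := one_pos.trans hδ
  obtain ⟨κ, hκ, h⟩ := hf.exists_residualSq_eq hM (α := α) (c := α ^ 2 / δ) (by positivity)
    (div_lt_self (by positivity) hδ)
  exact ⟨κ, hκ, by rw [h]; field_simp⟩

/-- Bounds the ratio `α / κ`, both for the slope and for compactness as `α → 0`. -/
lemma le_of_scale {α κ : ℝ} (hα : 0 < α) (hκ : 0 < κ)
    (h : α ^ 2 = δ * residualSq P G Z f α κ) : α ≤ δ * κ * K := by
  have hδ0 : 0 < δ := one_pos.trans hδ
  have hK := hf.pos
  have h1 := hf.residualSq_le hM α hκ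
  have h2 : α ^ 2 ≤ (δ * κ * K) ^ 2 := by
    rw [h]
    calc δ * residualSq P G Z f α κ ≤ δ * (κ * K) ^ 2 := by gcongr
      _ ≤ δ ^ 2 * (κ * K) ^ 2 := by gcongr; nlinarith
      _ = (δ * κ * K) ^ 2 := by ring
  exact (pow_le_pow_iff_left₀ hα.le (by positivity) two_ne_zero).1 h2

lemma abs_slope_le {α κ : ℝ} (hα : 0 < α) (hκ : 0 < κ)
    (h : α ^ 2 = δ * residualSq P G Z f α κ) :
    |(residualCov P G Z f α κ - α / δ) / κ| ≤ 2 * K := by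
  have hδ0 : 0 < δ := one_pos.trans hδ
  have hK := hf.pos
  have h1 : |residualCov P G Z f α κ| ≤ κ * K := by
    have hG := hM.memLp.integrable one_le_two
    calc |residualCov P G Z f α κ| ≤ ∫ ω, |proxResidual G Z f α κ ω * G ω| ∂P :=
          abs_integral_le_integral_abs
      _ ≤ ∫ ω, κ * K * |G ω| ∂P := by
          refine integral_mono
            ((hf.memLp_proxResidual hM α hκ).integrable_mul_of_two hM.memLp).abs
            (hG.abs.const_mul _) fun ω => ?_
          simp only [abs_mul]
          gcongr
          exact hf.abs_proxResidual_le α hκ ω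
      _ ≤ κ * K := by
          rw [integral_const_mul]
          exact mul_le_of_le_one_right (by positivity) hM.integral_abs_signal_le
  have h2 : α / δ ≤ κ * K := by
    rw [div_le_iff₀ hδ0]
    linarith [hf.le_of_scale hM hδ hα hκ h]
  have h3 : 0 < α / δ := by positivity
  rw [abs_div, abs_of_pos hκ, div_le_iff₀ hκ]
  refine (abs_sub _ _).trans ?_
  rw [abs_of_pos h3]
  linarith

lemma integral_displacement_sq {α κ : ℝ} (hκ : 0 < κ)
    (h : α ^ 2 = δ * residualSq P G Z f α κ) :
    ∫ ω, (α * G ω - proxResidual G Z f α κ ω) ^ 2 ∂P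
      = α ^ 2 - 2 * α * residualCov P G Z f α κ + α ^ 2 / δ := by
  have hδ0 : 0 < δ := one_pos.trans hδ
  have hρ : residualSq P G Z f α κ = α ^ 2 / δ := by rw [h]; field_simp
  have h1 := (hf.memLp_proxResidual hM α hκ).integral_sq_add hM.memLp (-1) α
  rw [hM.integral_signal_sq] at h1
  rw [residualSq] at hρ
  rw [hρ] at h1
  rw [residualCov]
  have e : ∀ ω, (α * G ω - proxResidual G Z f α κ ω) ^ 2
      = (-1 * proxResidual G Z f α κ ω + α * G ω) ^ 2 := fun ω => by ring
  simp_rw [e]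
  rw [h1]
  ring

lemma abs_residualCov_le {α κ : ℝ} (hα : 0 < α) (hκ : 0 < κ)
    (h : α ^ 2 = δ * residualSq P G Z f α κ) : |residualCov P G Z f α κ| ≤ α := by
  have hδ0 : 0 < δ := one_pos.trans hδ
  have hρ : residualSq P G Z f α κ = α ^ 2 / δ := by rw [h]; field_simp
  have hρ' : residualSq P G Z f α κ ≤ α ^ 2 := by
    rw [hρ]; exact div_le_self (by positivity) hδ.le
  have hG : ∫ ω, G ω ^ 2 ∂P ≤ 1 ^ 2 := by rw [hM.integral_signal_sq]; norm_num
  have hG' : ∫ ω, (-G ω) ^ 2 ∂P ≤ 1 ^ 2 := by simpa using hG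
  have h1 := (hf.memLp_proxResidual hM α hκ).integral_mul_le_of_sq_le hM.memLp hα zero_le_one
    hρ' hG
  have h2 := (hf.memLp_proxResidual hM α hκ).integral_mul_le_of_sq_le hM.memLp.neg hα zero_le_one
    hρ' hG'
  simp only [Pi.neg_apply, mul_neg, integral_neg, mul_one] at h1 h2
  rw [residualCov, abs_le]
  constructor <;> linarith

lemma integral_displacement_sq_le {α κ : ℝ} (hα : 0 < α) (hκ : 0 < κ)
    (h : α ^ 2 = δ * residualSq P G Z f α κ) :
    ∫ ω, (α * G ω - proxResidual G Z f α κ ω) ^ 2 ∂P ≤ (2 * α) ^ 2 := by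
  rw [hf.integral_displacement_sq hM hδ hκ h]
  have h1 := (abs_le.1 (hf.abs_residualCov_le hM hδ hα hκ h)).1
  have h2 : α ^ 2 / δ ≤ α ^ 2 := div_le_self (by positivity) hδ.le
  nlinarith

lemma neg_le_excessRisk {α κ : ℝ} (hα : 0 < α) (hκ : 0 < κ)
    (h : α ^ 2 = δ * residualSq P G Z f α κ) :
    -(2 * K * α) ≤ excessRisk P Z f fun ω => α * G ω - proxResidual G Z f α κ ω := by
  have hv := hf.memLp_displacement hM α hκ
  have h1 := (abs_le.1 (hf.abs_excessRisk_le hM.measurable_noise (hv.integrable one_le_two))).1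
  have h2 := hv.abs.integral_mul_le_of_sq_le (v := fun _ => (1 : ℝ)) (memLp_const 1)
    (a := 2 * α) (b := 1) (by positivity) zero_le_one
    (by simpa [sq_abs] using hf.integral_displacement_sq_le hM hδ hα hκ h) (by simp)
  simp only [mul_one] at h2
  have := mul_le_mul_of_nonneg_left h2 hf.pos.le
  have e : ∫ ω, |α * G ω - proxResidual G Z f α κ ω| ∂P
    = ∫ ω, |fun ω => α * G ω - proxResidual G Z f α κ ω| ω ∂P := rfl
  rw [e] at h1
  linarith

end RobustLoss

/-! ### Growth of the risk and first-order optimality. -/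

omit [IsProbabilityMeasure P] in
-- Testing the displacement against a bounded surrogate of `G` bounds its first absolute moment
-- below, which is what linear growth of the loss needs.
lemma GaussianNoise.exists_truncation (hM : GaussianNoise P G Z) {η : ℝ} (hη : η < 1) :
    ∃ B > 0, ∃ T : Ω → ℝ, Measurable T ∧ (∀ ω, |T ω| ≤ B) ∧ (∀ ω, |T ω| ≤ |G ω|) ∧
      η < ∫ ω, G ω * T ω ∂P := by
  set T : ℕ → Ω → ℝ := fun n ω => max (-(n : ℝ)) (min n (G ω)) with hT
  have hmeas : ∀ n, Measurable (T n) := fun n =>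
    measurable_const.max (measurable_const.min hM.measurable_signal)
  have hTn : ∀ n ω, |T n ω| ≤ n := fun n ω => by
    have hn : (0 : ℝ) ≤ n := n.cast_nonneg
    rw [abs_le]
    exact ⟨le_max_left _ _, max_le (by linarith) (min_le_left _ _)⟩
  have hTG : ∀ n ω, |T n ω| ≤ |G ω| := fun n ω => by
    have hn : (0 : ℝ) ≤ n := n.cast_nonneg
    have h1 := neg_abs_le (G ω)
    have h2 := le_abs_self (G ω)
    have h3 := abs_nonneg (G ω)
    rw [abs_le]
    constructor
    · exact (le_min (by linarith) h1).trans (le_max_right _ _)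
    · exact max_le (by linarith) ((min_le_right _ _).trans h2)
  have hlim : Filter.Tendsto (fun n => ∫ ω, G ω * T n ω ∂P) Filter.atTop
      (nhds (∫ ω, G ω ^ 2 ∂P)) := by
    refine tendsto_integral_of_dominated_convergence (fun ω => G ω ^ 2)
      (fun n => (hM.measurable_signal.mul (hmeas n)).aestronglyMeasurable)
      hM.memLp.integrable_sq (fun n => Filter.Eventually.of_forall fun ω => ?_)
      (Filter.Eventually.of_forall fun ω => ?_)
    · rw [Real.norm_eq_abs, abs_mul, ← sq_abs, sq]
      exact mul_le_mul_of_nonneg_left (hTG n ω) (abs_nonneg _)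
    · refine tendsto_const_nhds.congr' ?_
      filter_upwards [Filter.eventually_ge_atTop ⌈|G ω|⌉₊] with n hn
      have h1 := (abs_le.1 ((Nat.le_ceil _).trans (Nat.cast_le.2 hn) : |G ω| ≤ n))
      simp only [hT]
      rw [min_eq_right h1.2, max_eq_right h1.1, sq]
  rw [hM.integral_signal_sq] at hlim
  obtain ⟨n, hn, hn1⟩ := ((hlim.eventually_const_lt hη).and
    (Filter.eventually_ge_atTop 1)).exists
  exact ⟨n, by exact_mod_cast hn1, T n, hmeas n, hTn n, hTG n, hn⟩

lemma exists_tail_le (hZ : Measurable Z) {ε : ℝ} (hε : 0 < ε) :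
    ∃ r, 0 ≤ r ∧ ∫ ω, (if r < |Z ω| then (1 : ℝ) else 0) ∂P ≤ ε := by
  have hlim : Filter.Tendsto (fun n : ℕ => ∫ ω, (if (n : ℝ) < |Z ω| then (1 : ℝ) else 0) ∂P)
      Filter.atTop (nhds (∫ _, (0 : ℝ) ∂P)) := by
    refine tendsto_integral_of_dominated_convergence (fun _ => 1)
      (fun n => (Measurable.ite (measurableSet_lt measurable_const hZ.abs) measurable_const
        measurable_const).aestronglyMeasurable)
      (integrable_const _) (fun n => Filter.Eventually.of_forall fun ω => ?_)
      (Filter.Eventually.of_forall fun ω => ?_)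
    · split_ifs <;> simp
    · refine tendsto_const_nhds.congr' ?_
      filter_upwards [Filter.eventually_ge_atTop ⌈|Z ω|⌉₊] with n hn
      rw [if_neg (not_lt.2 ((Nat.le_ceil _).trans (Nat.cast_le.2 hn)))]
  rw [integral_zero] at hlim
  obtain ⟨n, hn⟩ := (hlim.eventually_lt_const hε).exists
  exact ⟨n, n.cast_nonneg, hn.le⟩

namespace RobustLoss

variable (hf : RobustLoss f K) (hM : GaussianNoise P G Z) {δ : ℝ} (hδ : 1 < δ)
include hf hM hδ

/-- The risk is positive for large `α`. -/
lemma exists_excessRisk_pos {k : ℝ → ℝ} (hk : ∀ α, 0 < α → 0 < k α)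
    (hkα : ∀ α, 0 < α → α ^ 2 = δ * residualSq P G Z f α (k α)) :
    ∃ α, 0 < α ∧
      0 < excessRisk P Z f fun ω => α * G ω - proxResidual G Z f α (k α) ω := by
  have hδ0 : 0 < δ := one_pos.trans hδ
  have hK := hf.pos
  have hsδ : 1 < Real.sqrt δ := Real.lt_sqrt_of_sq_lt (by simpa using hδ)
  set η := 1 / Real.sqrt δ with hη
  have hη1 : η < 1 := by rw [hη, div_lt_one (by positivity)]; exact hsδ
  obtain ⟨c, hc, hgrow⟩ := hf.linear_growth
  obtain ⟨B, hB, T, hTm, hTB, hTG, hGT⟩ := hM.exists_truncation (η := (1 + η) / 2) (by linarith)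
  -- Chosen so that the error from large `|Z|`, at most `(K + c) * 2αb`, uses half of the main term
  -- `(c / B) * α(1 - η) / 2`.
  set b := c * (1 - η) / (8 * B * (K + c)) with hb
  have hb0 : 0 < b := by
    have : 0 < 1 - η := by linarith
    positivity
  obtain ⟨r, hr, hrb⟩ := exists_tail_le (P := P) hM.measurable_noise (pow_pos hb0 2)
  set A : Ω → ℝ := fun ω => if r < |Z ω| then (1 : ℝ) else 0 with hA
  have hAm : Measurable A := Measurable.ite
    (measurableSet_lt measurable_const hM.measurable_noise.abs) measurable_const measurable_const
  have hA1 : ∀ ω, A ω ^ 2 = A ω := fun ω => by simp only [hA]; split_ifs <;> simp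
  have hAL : MemLp A 2 P := MemLp.of_bound hAm.aestronglyMeasurable 1
    (Filter.Eventually.of_forall fun ω => by simp only [hA]; split_ifs <;> simp)
  have hTL : MemLp T 2 P := MemLp.of_bound hTm.aestronglyMeasurable B
    (Filter.Eventually.of_forall hTB)
  have hT1 : ∫ ω, T ω ^ 2 ∂P ≤ 1 ^ 2 := by
    rw [one_pow, ← hM.integral_signal_sq]
    exact integral_mono hTL.integrable_sq hM.memLp.integrable_sq fun ω => sq_le_sq.2 (hTG ω)
  set C := c + (c + K) * r with hC
  have hC0 : 0 < C := by positivity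
  have hlow : ∀ α, 0 < α → α * (c * (1 - η) / (4 * B)) - C
      ≤ excessRisk P Z f fun ω => α * G ω - proxResidual G Z f α (k α) ω := by
    intro α hα
    have hκ := hk α hα
    have hsc := hkα α hα
    set R := proxResidual G Z f α (k α) with hR
    have hRL : MemLp R 2 P := hf.memLp_proxResidual hM α hκ
    have hvL : MemLp (fun ω => α * G ω - R ω) 2 P := hf.memLp_displacement hM α hκ
    have hv2 : ∫ ω, (α * G ω - R ω) ^ 2 ∂P ≤ (2 * α) ^ 2 :=
      hf.integral_displacement_sq_le hM hδ hα hκ hsc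
    -- Linear growth is used where `|Z| ≤ r`; on the rare complement only the Lipschitz bound is
    -- available.
    have hpt : ∀ ω, c / B * ((α * G ω - R ω) * T ω) - C - (K + c) * (|α * G ω - R ω| * A ω)
        ≤ f (Z ω + (α * G ω - R ω)) - f (Z ω) := by
      intro ω
      set v := α * G ω - R ω
      have h1 : c / B * (v * T ω) ≤ c * |v| := by
        have : v * T ω ≤ |v| * B := (le_abs_self _).trans (by rw [abs_mul]; gcongr; exact hTB ω)
        calc c / B * (v * T ω) ≤ c / B * (|v| * B) := by gcongr
          _ = c * |v| := by field_simp
      by_cases hZr : r < |Z ω|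
      · have hAv : A ω = 1 := by simp only [hA]; rw [if_pos hZr]
        have h2 := (abs_le.1 (hf.lip (Z ω + v) (Z ω))).1
        rw [add_sub_cancel_left] at h2
        rw [hAv]
        linarith
      · have hAv : A ω = 0 := by simp only [hA]; rw [if_neg hZr]
        have h2 := hgrow (Z ω + v)
        have h3 := (abs_le.1 (hf.lip (Z ω) 0)).2
        rw [sub_zero] at h3
        have h4 : |v| - |Z ω| ≤ |Z ω + v| := by
          have := abs_sub_abs_le_abs_sub v (-Z ω)
          rw [abs_neg, sub_neg_eq_add, add_comm v] at this
          exact this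
        have h5 := mul_le_mul_of_nonneg_left h4 hc.le
        have h6 := mul_le_mul_of_nonneg_left (not_lt.1 hZr) (add_pos hc hK).le
        rw [hAv]
        linarith
    have i1 := (hvL.integrable_mul_of_two hTL).const_mul (c / B)
    have i2 : Integrable (fun ω => |α * G ω - R ω| * A ω) P :=
      hvL.abs.integrable_mul_of_two hAL
    have i3 : Integrable (fun ω => c / B * ((α * G ω - R ω) * T ω) - C) P :=
      i1.sub (integrable_const C)
    have hint := integral_mono (i3.sub (i2.const_mul (K + c)))
      (hf.integrable_excess_displacement hM α hκ) hpt
    simp only [Pi.sub_apply] at hint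
    rw [integral_sub i3 (i2.const_mul _), integral_sub i1 (integrable_const _),
      integral_const_mul, integral_const_mul] at hint
    simp only [integral_const, probReal_univ, one_smul] at hint
    have hvT : α * ((1 - η) / 2) ≤ ∫ ω, (α * G ω - R ω) * T ω ∂P := by
      have e : ∀ ω, (α * G ω - R ω) * T ω = α * (G ω * T ω) - R ω * T ω := fun ω => by ring
      simp_rw [e]
      rw [integral_sub ((hM.memLp.integrable_mul_of_two hTL).const_mul _)
        (hRL.integrable_mul_of_two hTL), integral_const_mul]
      have h1 := hRL.integral_mul_le_of_sq_le hTL (a := α * η) (b := 1) (by positivity)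
        zero_le_one (by
          have h2 : residualSq P G Z f α (k α) = α ^ 2 / δ := by rw [hsc]; field_simp
          have h3 : (α * η) ^ 2 = α ^ 2 / δ := by
            rw [hη, mul_pow, div_pow, Real.sq_sqrt hδ0.le]; ring
          rw [h3, ← h2]
          exact le_rfl) hT1
      have h4 := mul_le_mul_of_nonneg_left hGT.le hα.le
      linarith
    have hvA : ∫ ω, |α * G ω - R ω| * A ω ∂P ≤ 2 * α * b := by
      refine hvL.abs.integral_mul_le_of_sq_le hAL (by positivity) hb0.le ?_ ?_
      · simpa [sq_abs] using hv2
      · simp_rw [hA1]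
        exact hrb
    have h1 := mul_le_mul_of_nonneg_left hvT (div_pos hc hB).le
    have h2 := mul_le_mul_of_nonneg_left hvA (add_pos hK hc).le
    have h3 : (K + c) * (2 * α * b) = α * (c * (1 - η) / (4 * B)) := by
      rw [hb]; field_simp; ring
    have h4 : c / B * (α * ((1 - η) / 2)) = 2 * (α * (c * (1 - η) / (4 * B))) := by
      field_simp; ring
    refine le_trans ?_ hint
    linarith
  have hs : 0 < c * (1 - η) / (4 * B) := by
    have : 0 < 1 - η := by linarith
    positivity
  refine ⟨(C + 1) / (c * (1 - η) / (4 * B)), by positivity, ?_⟩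
  have := hlow _ (div_pos (by positivity : 0 < C + 1) hs)
  rw [div_mul_cancel₀ _ hs.ne'] at this
  linarith

/-- Strict monotonicity in `κ` replaces the implicit function theorem: strict inequalities at fixed
`κ` persist for nearby `α` and trap `k`. -/
lemma continuousAt_scale (hZ : 0 < P {ω | Z ω ≠ 0}) {k : ℝ → ℝ} (hk : ∀ α, 0 < α → 0 < k α)
    (hkα : ∀ α, 0 < α → α ^ 2 = δ * residualSq P G Z f α (k α)) {α : ℝ} (hα : 0 < α) :
    ContinuousAt k α := by
  have hδ0 : 0 < δ := one_pos.trans hδ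
  have hcont : ∀ κ, 0 < κ → ContinuousAt (fun a => δ * residualSq P G Z f a κ - a ^ 2) α := by
    intro κ hκ
    have h1 := hf.continuousAt_residualSq hM (p := (α, κ)) hκ
    have h2 : ContinuousAt (fun a : ℝ => (a, κ)) α := by fun_prop
    have h3 := ContinuousAt.comp (f := fun a : ℝ => (a, κ)) h1 h2
    exact (h3.const_mul δ).sub (by fun_prop)
  have hpos : ∀ᶠ a in nhds α, 0 < a := Ioi_mem_nhds hα
  refine tendsto_order.2 ⟨fun a ha => ?_, fun b hb => ?_⟩
  · rcases le_or_gt a 0 with h0 | h0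
    · filter_upwards [hpos] with x hx
      exact h0.trans_lt (hk x hx)
    · have h1 := hf.residualSq_strictMono hM α h0 ha hZ hα
      have h2 : δ * residualSq P G Z f α a - α ^ 2 < 0 := by
        have := mul_lt_mul_of_pos_left h1 hδ0
        rw [← hkα α hα] at this
        linarith
      filter_upwards [hpos, (hcont a h0).eventually_lt_const h2] with x hx hxa
      by_contra! hle
      have h3 := mul_le_mul_of_nonneg_left (hf.residualSq_mono hM x (hk x hx) hle) hδ0.le
      rw [← hkα x hx] at h3
      linarith
  · have hb0 := (hk α hα).trans hb
    have h1 := hf.residualSq_strictMono hM α (hk α hα) hb hZ hα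
    have h2 : 0 < δ * residualSq P G Z f α b - α ^ 2 := by
      have := mul_lt_mul_of_pos_left h1 hδ0
      rw [← hkα α hα] at this
      linarith
    filter_upwards [hpos, (hcont b hb0).eventually_const_lt h2] with x hx hxb
    by_contra! hle
    have h3 := mul_le_mul_of_nonneg_left (hf.residualSq_mono hM x hb0 hle) hδ0.le
    rw [← hkα x hx] at h3
    linarith

/-- A positive minimizer of the risk solves the system. -/
lemma solvesSystem_of_minimizer (hZ : 0 < P {ω | Z ω ≠ 0}) {k : ℝ → ℝ}
    (hk : ∀ α, 0 < α → 0 < k α)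
    (hkα : ∀ α, 0 < α → α ^ 2 = δ * residualSq P G Z f α (k α)) {α : ℝ} (hα : 0 < α)
    (hmin : ∀ a, 0 < a → excessRisk P Z f (fun ω => α * G ω - proxResidual G Z f α (k α) ω)
      ≤ excessRisk P Z f fun ω => a * G ω - proxResidual G Z f a (k a) ω) :
    SolvesSystem P G Z f δ α (k α) := by
  have hδ0 : 0 < δ := one_pos.trans hδ
  refine ⟨hkα α hα, ?_⟩
  set h : ℝ → ℝ := fun a => residualCov P G Z f a (k a) - a / δ with hh
  have hcont : ContinuousAt h α := by
    have h1 := hf.continuousAt_residualCov hM (p := (α, k α)) (hk α hα)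
    have h2 : ContinuousAt (fun a : ℝ => (a, k a)) α :=
      continuousAt_id.prodMk (hf.continuousAt_scale hM hδ hZ hk hkα hα)
    exact (ContinuousAt.comp (f := fun a : ℝ => (a, k a)) h1 h2).sub (by fun_prop)
  -- Slopes are nonpositive left of the minimizer and nonnegative right of it; continuity of `h`
  -- makes its value at `α` zero.
  have hsgn : ∀ a, 0 < a → h a * (α - a) ≤ 0 := by
    intro a ha
    have h1 := hf.excessRisk_add_le hM hδ0 ha hα.le (hk a ha) (hkα a ha)
      (hf.memLp_proxResidual hM α (hk α hα)) (by
        have : residualSq P G Z f α (k α) = α ^ 2 / δ := by rw [hkα α hα]; field_simp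
        exact this.le)
    have h2 := hmin a ha
    have h3 : h a / k a * (α - a) ≤ 0 := by simp only [hh]; linarith
    rw [div_mul_eq_mul_div] at h3
    by_contra! hpos
    exact absurd h3 (not_le.2 (div_pos hpos (hk a ha)))
  have hge : 0 ≤ h α := by
    refine ge_of_tendsto (hcont.tendsto.mono_left (nhdsWithin_le_nhds (s := Set.Ioi α))) ?_
    filter_upwards [self_mem_nhdsWithin] with a ha
    have ha' : α < a := ha
    have := hsgn a (hα.trans ha')
    by_contra! hneg
    nlinarith
  have hle : h α ≤ 0 := by
    refine le_of_tendsto (hcont.tendsto.mono_left (nhdsWithin_le_nhds (s := Set.Iio α))) ?_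
    filter_upwards [self_mem_nhdsWithin, nhdsWithin_le_nhds (Ioi_mem_nhds hα)] with a ha ha0
    have ha' : a < α := ha
    have := hsgn a ha0
    by_contra! hneg
    nlinarith
  have h0 : residualCov P G Z f α (k α) = α / δ := by
    have := le_antisymm hle hge
    simp only [hh] at this
    linarith
  rw [residualCov] at h0
  rw [h0]
  field_simp

end RobustLoss

/-! ### The threshold for perfect recovery. -/

omit [IsProbabilityMeasure P] in
/-- Random variables whose second moments tend to zero converge to zero almost everywhere along a
subsequence. -/
lemma exists_subseq_ae_tendsto_zero {v : ℕ → Ω → ℝ} (hv : ∀ n, MemLp (v n) 2 P)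
    (hlim : Filter.Tendsto (fun n => ∫ ω, v n ω ^ 2 ∂P) Filter.atTop (nhds 0)) :
    ∃ φ : ℕ → ℕ, StrictMono φ ∧
      ∀ᵐ ω ∂P, Filter.Tendsto (fun n => v (φ n) ω) Filter.atTop (nhds 0) := by
  have hnorm : Filter.Tendsto (fun n => eLpNorm (v n - fun _ => 0) 2 P) Filter.atTop
      (nhds 0) := by
    have h1 : ∀ n, eLpNorm (v n - fun _ => 0) 2 P
        = ENNReal.ofReal (Real.sqrt (∫ ω, v n ω ^ 2 ∂P)) := by
      intro n
      have e : (v n - fun _ => 0) = v n := by ext; simp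
      rw [e, (hv n).eLpNorm_eq_integral_rpow_norm two_ne_zero ENNReal.ofNat_ne_top,
        Real.sqrt_eq_rpow]
      simp
    simp_rw [h1]
    have h2 := ENNReal.tendsto_ofReal ((Real.continuous_sqrt.tendsto 0).comp hlim)
    simpa using h2
  exact (tendstoInMeasure_of_tendsto_eLpNorm (two_ne_zero) (fun n => (hv n).1)
    aestronglyMeasurable_const hnorm).exists_seq_tendsto_ae

omit [IsProbabilityMeasure P] in
lemma deltaPerfect_le {δ : ℝ} (hδ : 1 < δ) {t : ℝ} (ht : 0 < t)
    (h : ∫⁻ ω, ENNReal.ofReal (Metric.infDist (G ω) (t • subdiff f (Z ω)) ^ 2) ∂P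
      ≤ ENNReal.ofReal (1 - 1 / δ)) : deltaPerfect P G Z f ≤ ENNReal.ofReal δ := by
  have h1 : (⨅ (t : ℝ) (_ : 0 < t),
      ∫⁻ ω, ENNReal.ofReal (Metric.infDist (G ω) (t • subdiff f (Z ω)) ^ 2) ∂P)
      ≤ ENNReal.ofReal (1 - 1 / δ) := iInf₂_le_of_le t ht h
  have h2 : (ENNReal.ofReal δ)⁻¹ ≤ 1 - ENNReal.ofReal (1 - 1 / δ) := by
    have h3 : 1 / δ ≤ 1 := (div_le_one (one_pos.trans hδ)).2 hδ.le
    rw [← ENNReal.ofReal_inv_of_pos (one_pos.trans hδ), ← ENNReal.ofReal_one,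
      ← ENNReal.ofReal_sub _ (by linarith)]
    apply ENNReal.ofReal_le_ofReal
    rw [one_div]
    linarith
  rw [deltaPerfect, ENNReal.inv_le_iff_inv_le]
  exact h2.trans (tsub_le_tsub_left h1 1)

namespace RobustLoss

variable (hf : RobustLoss f K) (hM : GaussianNoise P G Z) {δ : ℝ} (hδ : 1 < δ)
include hf hM hδ

/-- If the risk has nonnegative slope at every positive `α`, then `δ` is at least the threshold for
perfect recovery. -/
lemma deltaPerfect_le_of_slope_nonneg (hZ : 0 < P {ω | Z ω ≠ 0}) {k : ℝ → ℝ}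
    (hk : ∀ α, 0 < α → 0 < k α)
    (hkα : ∀ α, 0 < α → α ^ 2 = δ * residualSq P G Z f α (k α))
    (hslope : ∀ α, 0 < α → α / δ ≤ residualCov P G Z f α (k α)) :
    deltaPerfect P G Z f ≤ ENNReal.ofReal δ := by
  have hδ0 : 0 < δ := one_pos.trans hδ
  have hK := hf.pos
  set a : ℕ → ℝ := fun n => 1 / ((n : ℝ) + 1) with ha
  have ha0 : ∀ n, 0 < a n := fun n => by simp only [ha]; positivity
  have halim : Filter.Tendsto a Filter.atTop (nhds 0) := tendsto_one_div_add_atTop_nhds_zero_nat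
  set v : ℕ → Ω → ℝ := fun n ω => a n * G ω - proxResidual G Z f (a n) (k (a n)) ω with hv
  have hvL : ∀ n, MemLp (v n) 2 P := fun n => hf.memLp_displacement hM _ (hk _ (ha0 n))
  -- The sign of the slope enters here, through the cross term `-2α E[R G] ≤ -2α² / δ`.
  have hv2 : ∀ n, ∫ ω, v n ω ^ 2 ∂P ≤ a n ^ 2 * (1 - 1 / δ) := by
    intro n
    simp only [hv]
    rw [hf.integral_displacement_sq hM hδ (hk _ (ha0 n)) (hkα _ (ha0 n))]
    have h1 := mul_le_mul_of_nonneg_left (hslope _ (ha0 n)) (ha0 n).le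
    have h2 : a n * (a n / δ) = a n ^ 2 / δ := by ring
    have h3 : a n ^ 2 * (1 - 1 / δ) = a n ^ 2 - a n ^ 2 / δ := by ring
    linarith
  have hv2lim : Filter.Tendsto (fun n => ∫ ω, v n ω ^ 2 ∂P) Filter.atTop (nhds 0) := by
    refine squeeze_zero (fun n => integral_nonneg fun ω => sq_nonneg _) hv2 ?_
    simpa using (halim.pow 2).mul_const (1 - 1 / δ)
  obtain ⟨φ, hφ, hφlim⟩ := exists_subseq_ae_tendsto_zero hvL hv2lim
  set b : ℕ → ℝ := fun n => a n / k (a n) with hb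
  have hbmem : ∀ n, b (φ n) ∈ Set.Icc 0 (δ * K) := by
    intro n
    have h1 := hk _ (ha0 (φ n))
    have h2 := hf.le_of_scale hM hδ (ha0 (φ n)) h1 (hkα _ (ha0 (φ n)))
    refine ⟨(div_pos (ha0 _) h1).le, ?_⟩
    simp only [hb]
    rw [div_le_iff₀ h1]
    linarith
  obtain ⟨ρ, hρ, ψ, hψ, hψlim⟩ := isCompact_Icc.tendsto_subseq hbmem
  set j : ℕ → ℕ := fun n => φ (ψ n) with hj
  have hblim : Filter.Tendsto (fun n => b (j n)) Filter.atTop (nhds ρ) := hψlim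
  -- The squared displacement over `κ²`: here `R / κ` is a subgradient near `Z` and `b = α / κ`
  -- tends to `ρ`, so the limit compares `ρG` with the subdifferential at `Z`.
  set F : ℕ → Ω → ℝ≥0∞ := fun n ω => ENNReal.ofReal
    ((b (j n) * G ω - proxResidual G Z f (a (j n)) (k (a (j n))) ω / k (a (j n))) ^ 2) with hF
  have hFm : ∀ n, Measurable (F n) := fun n =>
    (((hM.measurable_signal.const_mul _).sub
      ((hf.measurable_proxResidual hM _ (hk _ (ha0 _))).div_const _)).pow_const 2).ennreal_ofReal
  have hFint : ∀ n, ∫⁻ ω, F n ω ∂P ≤ ENNReal.ofReal (b (j n) ^ 2 * (1 - 1 / δ)) := by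
    intro n
    have hκ := hk _ (ha0 (j n))
    have e : ∀ ω, (b (j n) * G ω - proxResidual G Z f (a (j n)) (k (a (j n))) ω / k (a (j n))) ^ 2
        = (1 / k (a (j n)) ^ 2) * v (j n) ω ^ 2 := by
      intro ω
      simp only [hb, hv]
      field_simp
    simp only [hF]
    simp_rw [e]
    rw [← ofReal_integral_eq_lintegral_ofReal ((hvL (j n)).integrable_sq.const_mul _)
      (Filter.Eventually.of_forall fun ω => by positivity), integral_const_mul]
    apply ENNReal.ofReal_le_ofReal
    calc 1 / k (a (j n)) ^ 2 * ∫ ω, v (j n) ω ^ 2 ∂P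
        ≤ 1 / k (a (j n)) ^ 2 * (a (j n) ^ 2 * (1 - 1 / δ)) := by gcongr; exact hv2 _
      _ = b (j n) ^ 2 * (1 - 1 / δ) := by simp only [hb]; ring
  have hfatou : ∫⁻ ω, Filter.liminf (fun n => F n ω) Filter.atTop ∂P
      ≤ ENNReal.ofReal (ρ ^ 2 * (1 - 1 / δ)) := by
    refine (lintegral_liminf_le hFm).trans ?_
    have h1 := ENNReal.tendsto_ofReal ((hblim.pow 2).mul_const (1 - 1 / δ))
    rw [← h1.liminf_eq]
    exact Filter.liminf_le_liminf (Filter.Eventually.of_forall hFint)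
  have hxlim : ∀ᵐ ω ∂P, Filter.Tendsto (fun n => Z ω + v (j n) ω) Filter.atTop
      (nhds (Z ω)) := by
    filter_upwards [hφlim] with ω hω
    simpa using (hω.comp hψ.tendsto_atTop).const_add (Z ω)
  have hmem : ∀ ω n, proxResidual G Z f (a (j n)) (k (a (j n))) ω / k (a (j n))
      ∈ subdiff f (Z ω + v (j n) ω) := fun ω n =>
    hf.proxResidual_div_mem _ (hk _ (ha0 _)) ω
  have hdist : ∀ᵐ ω ∂P, ENNReal.ofReal (Metric.infDist (ρ * G ω) (subdiff f (Z ω)) ^ 2)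
      ≤ Filter.liminf (fun n => F n ω) Filter.atTop := by
    filter_upwards [hxlim] with ω hω
    exact hf.infDist_sq_le_liminf hω (hmem ω) hblim
  -- If `ρ = 0`, then `0` is almost surely a subgradient at `Z`, so `Z = 0` almost surely. Otherwise
  -- `t = 1 / ρ` is the required scale.
  rcases hρ.1.eq_or_lt with h0 | hpos
  · exfalso
    rw [← h0] at hfatou hdist
    have h1 : ∫⁻ ω, Filter.liminf (fun n => F n ω) Filter.atTop ∂P = 0 := by
      simpa using hfatou
    rw [lintegral_eq_zero_iff (Measurable.liminf hFm)] at h1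
    have h2 : ∀ᵐ ω ∂P, Z ω = 0 := by
      filter_upwards [h1, hdist, hxlim] with ω h3 h4 h5
      obtain ⟨s, hs, -⟩ := hf.exists_subseq_tendsto_mem_subdiff h5 (hmem ω)
      have h6 : Metric.infDist (0 * G ω) (subdiff f (Z ω)) ^ 2 ≤ 0 := by
        rw [← ENNReal.ofReal_eq_zero]
        exact le_antisymm (h4.trans h3.le) zero_le
      have h7 : Metric.infDist (0 * G ω) (subdiff f (Z ω)) = 0 :=
        (pow_eq_zero_iff two_ne_zero).1 (le_antisymm h6 (sq_nonneg _))
      rw [← (isClosed_subdiff f (Z ω)).mem_iff_infDist_zero ⟨s, hs⟩, zero_mul] at h7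
      exact hf.eq_zero_of_zero_mem_subdiff h7
    exact hZ.ne' h2
  · refine deltaPerfect_le hδ (t := ρ⁻¹) (inv_pos.2 hpos) ?_
    have e : ∀ ω, ENNReal.ofReal (Metric.infDist (G ω) (ρ⁻¹ • subdiff f (Z ω)) ^ 2)
        = ENNReal.ofReal (ρ⁻¹ ^ 2)
          * ENNReal.ofReal (Metric.infDist (ρ * G ω) (subdiff f (Z ω)) ^ 2) := by
      intro ω
      have h1 := infDist_smul₀ (inv_ne_zero hpos.ne') (subdiff f (Z ω)) (ρ * G ω)
      rw [smul_eq_mul, inv_mul_cancel_left₀ hpos.ne', Real.norm_eq_abs,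
        abs_of_pos (inv_pos.2 hpos)] at h1
      rw [h1, mul_pow, ENNReal.ofReal_mul (by positivity)]
    simp_rw [e]
    rw [lintegral_const_mul' _ _ ENNReal.ofReal_ne_top]
    calc ENNReal.ofReal (ρ⁻¹ ^ 2)
          * ∫⁻ ω, ENNReal.ofReal (Metric.infDist (ρ * G ω) (subdiff f (Z ω)) ^ 2) ∂P
        ≤ ENNReal.ofReal (ρ⁻¹ ^ 2) * ENNReal.ofReal (ρ ^ 2 * (1 - 1 / δ)) := by
          gcongr
          exact (lintegral_mono_ae hdist).trans hfatou
      _ = ENNReal.ofReal (1 - 1 / δ) := by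
          rw [← ENNReal.ofReal_mul (by positivity)]
          congr 1
          field_simp

end RobustLoss

end RiskAnalysis

/-! ### Assembly of the theorem. -/

theorem theorem1 {Ω : Type*} [MeasurableSpace Ω] (P : Measure Ω) [IsProbabilityMeasure P]
    (G Z : Ω → ℝ) (hG : Measurable G) (hZ : Measurable Z)
    (hGlaw : P.map G = gaussianReal 0 1) (hGZ : IndepFun G Z P)
    (loss : ℝ → ℝ) (hconv : ConvexOn ℝ Set.univ loss) (hlip : ∃ K, LipschitzWith K loss)
    (hargmin : argminSet loss = {0})
    (δ : ℝ) (hδ : 1 < δ) (hZ0 : 0 < P {ω | Z ω ≠ 0}) :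
    (∀ α : ℝ, 0 ≤ α → ∃ m : ℝ, potential P G Z loss δ α = (m : EReal)) ∧
    ∃ αs : ℝ,
      (0 ≤ αs ∧ (∀ α, 0 ≤ α → potential P G Z loss δ αs ≤ potential P G Z loss δ α)) ∧
      (∀ a, 0 ≤ a → (∀ α, 0 ≤ α → potential P G Z loss δ a ≤ potential P G Z loss δ α) →
        a = αs) ∧
      (ENNReal.ofReal δ < deltaPerfect P G Z loss →
        0 < αs ∧
        ∃ κs : ℝ, 0 < κs ∧ SolvesSystem P G Z loss δ αs κs ∧
          ∀ α κ : ℝ, 0 < α → 0 < κ → SolvesSystem P G Z loss δ α κ → α = αs ∧ κ = κs) := by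
  have hδ0 : 0 < δ := one_pos.trans hδ
  have hM : GaussianNoise P G Z := ⟨hG, hZ, hGlaw, hGZ⟩
  obtain ⟨K₀, hK₀⟩ := hlip
  have hf : RobustLoss loss (K₀ + 1) := by
    refine ⟨hconv, fun x y => ?_, by positivity, hargmin⟩
    have h1 := hK₀.dist_le_mul x y
    rw [Real.dist_eq, Real.dist_eq] at h1
    have h2 := abs_nonneg (x - y)
    linarith
  have hscale : ∀ α, 0 < α → ∃ κ, 0 < κ ∧ α ^ 2 = δ * residualSq P G Z loss α κ :=
    fun α hα => hf.exists_scale hM hδ hα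
  choose! k hk hkα using hscale
  -- The value `0` at `α = 0` puts that endpoint under the same risk formula and the same constraint
  -- on `E[S²]`.
  set S : ℝ → Ω → ℝ := fun α => if 0 < α then proxResidual G Z loss α (k α) else 0 with hS
  set m : ℝ → ℝ := fun α => excessRisk P Z loss fun ω => α * G ω - S α ω with hm
  have hSpos : ∀ α, 0 < α → S α = proxResidual G Z loss α (k α) := fun α hα => if_pos hα
  have hS0 : S 0 = 0 := if_neg (lt_irrefl _)
  have hmpos : ∀ α, 0 < α →
      m α = excessRisk P Z loss fun ω => α * G ω - proxResidual G Z loss α (k α) ω := by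
    intro α hα
    simp only [hm, hSpos α hα]
  have hm0 : m 0 = 0 := by simp [hm, hS0, excessRisk]
  have hSL : ∀ α, 0 ≤ α → MemLp (S α) 2 P := by
    intro α hα
    rcases hα.eq_or_lt with rfl | hα
    · rw [hS0]; exact MemLp.zero
    · rw [hSpos α hα]; exact hf.memLp_proxResidual hM α (hk α hα)
  have hS2 : ∀ α, 0 ≤ α → ∫ ω, S α ω ^ 2 ∂P ≤ α ^ 2 / δ := by
    intro α hα
    rcases hα.eq_or_lt with rfl | hα
    · simp [hS0]
    · rw [hSpos α hα, le_div_iff₀ hδ0, hkα α hα, mul_comm]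
      exact le_rfl
  have hpot : ∀ α, 0 ≤ α → potential P G Z loss δ α = (m α : EReal) := by
    intro α hα
    rcases hα.eq_or_lt with rfl | hα
    · rw [hm0]; exact hf.potential_zero hM hδ0
    · rw [hmpos α hα]; exact hf.potential_eq hM hδ0 hα (hk α hα) (hkα α hα)
  have hsub : ∀ a, 0 < a → ∀ b, 0 ≤ b →
      m a + (residualCov P G Z loss a (k a) - a / δ) / k a * (b - a) ≤ m b := by
    intro a ha b hb
    rw [hmpos a ha]
    exact hf.excessRisk_add_le hM hδ0 ha hb (hk a ha) (hkα a ha) (hSL b hb) (hS2 b hb)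
  obtain ⟨αs, hαs, hmin⟩ := exists_forall_le_of_subgradient hsub
    (fun a ha => hf.abs_slope_le hM hδ ha (hk a ha) (hkα a ha)) hm0
    (fun a ha => (hf.neg_le_excessRisk hM hδ ha (hk a ha) (hkα a ha)).trans_eq (hmpos a ha).symm)
    (by
      obtain ⟨a, ha, hpos⟩ := hf.exists_excessRisk_pos hM hδ hk hkα
      exact ⟨a, ha, hpos.trans_eq (hmpos a ha).symm⟩)
  have hsolve : ∀ a, 0 < a → (∀ α, 0 ≤ α → m a ≤ m α) → SolvesSystem P G Z loss δ a (k a) := by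
    intro a ha hmin
    refine hf.solvesSystem_of_minimizer hM hδ hZ0 hk hkα ha fun b hb => ?_
    rw [← hmpos a ha, ← hmpos b hb]
    exact hmin b hb.le
  have hunique : ∀ a, 0 ≤ a → (∀ α, 0 ≤ α → m a ≤ m α) → ∀ α κ, 0 < α → 0 < κ →
      SolvesSystem P G Z loss δ α κ → a = α := by
    intro a ha hmin α κ hα hκ hsol
    refine hf.eq_of_excessRisk_le hM hδ0 hα ha hκ hsol hZ0 (hSL a ha) (hS2 a ha) ?_
    have h1 := hmin α hα.le
    have h2 := hf.potential_eq hM hδ0 hα hκ hsol.1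
    rw [hpot α hα.le, EReal.coe_eq_coe_iff] at h2
    rwa [h2] at h1
  refine ⟨fun α hα => ⟨m α, hpot α hα⟩, αs, ⟨hαs, fun α hα => ?_⟩, fun a ha hmina => ?_,
    fun hlt => ?_⟩
  · rw [hpot αs hαs, hpot α hα, EReal.coe_le_coe_iff]
    exact hmin α hα
  · have hmina' : ∀ α, 0 ≤ α → m a ≤ m α := by
      intro α hα
      have := hmina α hα
      rwa [hpot a ha, hpot α hα, EReal.coe_le_coe_iff] at this
    -- Rigidity needs one of the two minimizers to be positive, hence a solution of the system; the
    -- other may be `0`.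
    rcases hαs.eq_or_lt with h0 | hpos
    · rcases ha.eq_or_lt with h1 | hapos
      · rw [← h1, ← h0]
      · exact (hunique αs hαs hmin a (k a) hapos (hk a hapos) (hsolve a hapos hmina')).symm
    · exact hunique a ha hmina' αs (k αs) hpos (hk αs hpos) (hsolve αs hpos hmin)
  · have hpos : 0 < αs := by
      refine lt_of_le_of_ne hαs fun h0 => absurd hlt (not_lt.2 ?_)
      refine hf.deltaPerfect_le_of_slope_nonneg hM hδ hZ0 hk hkα fun α hα => ?_
      have h1 := hsub α hα 0 le_rfl
      have h2 := hmin α hα.le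
      rw [← h0] at h2
      have h3 : 0 ≤ (residualCov P G Z loss α (k α) - α / δ) / k α := by
        by_contra! hneg
        nlinarith
      have h4 := (div_nonneg_iff.1 h3).resolve_right fun h => absurd (hk α hα) (not_lt.2 h.2)
      linarith [h4.1]
    refine ⟨hpos, k αs, hk αs hpos, hsolve αs hpos hmin, fun α κ hα hκ hsol => ?_⟩
    have heq := hunique αs hαs hmin α κ hα hκ hsol
    refine ⟨heq.symm, ?_⟩
    subst heq
    have h1 : residualSq P G Z loss αs κ = residualSq P G Z loss αs (k αs) := by
      have h2 := hkα αs hpos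
      have h3 : αs ^ 2 = δ * residualSq P G Z loss αs κ := hsol.1
      rw [h3] at h2
      exact mul_left_cancel₀ hδ0.ne' h2
    rcases lt_trichotomy κ (k αs) with h | h | h
    · exact absurd h1 (hf.residualSq_strictMono hM αs hκ h hZ0 hpos).ne
    · exact h
    · exact absurd h1 (hf.residualSq_strictMono hM αs (hk αs hpos) h hZ0 hpos).ne'
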